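/- Let $\rho>0$. A $2\pi$-periodic function $h:\mathbb R\to\mathbb R$ is called $\rho$-trigonometrically convex, written $h\in TC_\rho$, if $$h(t_1)\sin\rho(t_2-t_3)+h(t_2)\sin\rho(t_3-t_1)+h(t_3)\sin\rho(t_1-t_2)\le 0$$ for all $t_1<t_2<t_3$ with $t_3-t_1<\pi/\rho$. For $h\in TC_\rho$ put $\widetilde h(t)=h(t/\rho)$ and, for $t\in\mathbb R$, $$\Pi_t=\{(x,y)\in\mathbb R^2: x\cos t+y\sin t\le\widetilde h(t)\},\qquad L_t=\partial\Pi_t,\qquad K_t=L_t\cap\bigcap_{|s-t|\le\pi/2}\Pi_s .$$ The locally trigonometrically convex curve associated with $h$ is $K_h=\bigcup_{t\in\mathbb R}K_t$. For $\alpha\in[0,2\pi\rho)$ the subarc $N_\alpha=\bigcup_{\alpha-2\pi<t<\alpha}K_t$ is called a nest for $K_h$ if $$\widetilde h(\alpha)=\widetilde h(\alpha-2\pi)\quad\text{and}\quad \widetilde h'_-(\alpha)\le\widetilde h'_+(\alpha-2\pi),$$ where $\widetilde h'_-$ and $\widetilde h'_+$ denote the left and right derivatives. Let $R_\alpha$ be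 the circumradius of $N_\alpha$, that is, the radius of the smallest closed disk containing $N_\alpha$, and put $$R^*_{\rm loc}=\sup\{R_\alpha: N_\alpha \text{ is a nest for } K_h\}.$$ **Proposition.** Let $h\in TC_\rho$. The supremum defining $R^*_{\rm loc}$ is attained: $$R^*_{\rm loc}=\max\{R_\alpha: N_\alpha\text{ is a nest for }K_h\}$$ (in particular, at least one nest exists). Furthermore, there exists a function $\tau\in TC_\rho$ such that $$h(t)+\tau(t)\le R^*_{\rm loc}\qquad\text{for all } t\in\mathbb R .$$ -/

import Mathlib

open Set Metric

noncomputable section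

namespace TrigConvex

/-- `h ∈ TC_ρ`: a `2π`-periodic function `h : ℝ → ℝ` that is `ρ`-trigonometrically convex. -/
structure TC (ρ : ℝ) (h : ℝ → ℝ) : Prop where
  periodic : Function.Periodic h (2 * Real.pi)
  ineq : ∀ t₁ t₂ t₃ : ℝ, t₁ < t₂ → t₂ < t₃ → t₃ - t₁ < Real.pi / ρ →
    h t₁ * Real.sin (ρ * (t₂ - t₃)) + h t₂ * Real.sin (ρ * (t₃ - t₁))
      + h t₃ * Real.sin (ρ * (t₁ - t₂)) ≤ 0

/-- The stretching `t ↦ h (t / ρ)`. -/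
def stretch (ρ : ℝ) (h : ℝ → ℝ) (t : ℝ) : ℝ := h (t / ρ)

/-- The half-plane `Π_t = {(x, y) : x cos t + y sin t ≤ h (t / ρ)}`, with `(x, y)` written as the
complex number `x + i y`. -/
def halfPlane (ρ : ℝ) (h : ℝ → ℝ) (t : ℝ) : Set ℂ :=
  {z | z.re * Real.cos t + z.im * Real.sin t ≤ stretch ρ h t}

/-- The support line `L_t`, the boundary of `Π_t`. -/
def supportLine (ρ : ℝ) (h : ℝ → ℝ) (t : ℝ) : Set ℂ :=
  {z | z.re * Real.cos t + z.im * Real.sin t = stretch ρ h t}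

/-- `K_t`, the part of `L_t` lying in `Π_s` for every `s ∈ [t - π/2, t + π/2]`. -/
def piece (ρ : ℝ) (h : ℝ → ℝ) (t : ℝ) : Set ℂ :=
  supportLine ρ h t ∩ ⋂ s ∈ Icc (t - Real.pi / 2) (t + Real.pi / 2), halfPlane ρ h s

/-- The subarc `K_I`, the union of the `K_t` over `t ∈ I`. For `I = ℝ` this is the whole locally
trigonometrically convex curve `K_h`. -/
def subarc (ρ : ℝ) (h : ℝ → ℝ) (I : Set ℝ) : Set ℂ := ⋃ t ∈ I, piece ρ h t

/-- The subarc `N_α = K_{(α - 2π, α)}`. -/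
def arc (ρ : ℝ) (h : ℝ → ℝ) (α : ℝ) : Set ℂ := subarc ρ h (Ioo (α - 2 * Real.pi) α)

/-- `N_α` is a nest for `K_h`: with `g` the stretching of `h`, `α ∈ [0, 2πρ)`,
`g α = g (α - 2π)`, and the left derivative `l` of `g` at `α` and the right derivative `r` of `g`
at `α - 2π` satisfy `l ≤ r`. -/
structure IsNest (ρ : ℝ) (h : ℝ → ℝ) (α : ℝ) : Prop where
  mem : α ∈ Ico 0 (2 * Real.pi * ρ)
  eq : stretch ρ h α = stretch ρ h (α - 2 * Real.pi)
  deriv_le : ∃ l r : ℝ, HasDerivWithinAt (stretch ρ h) l (Iic α) α ∧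
    HasDerivWithinAt (stretch ρ h) r (Ici (α - 2 * Real.pi)) (α - 2 * Real.pi) ∧ l ≤ r

/-- The circumradius of a plane set, the radius of the smallest closed disk containing it (see
`circumradius_isLeast` and `TC.isBounded_subarc` below). -/
def circumradius (E : Set ℂ) : ℝ := sInf {r : ℝ | 0 ≤ r ∧ ∃ c : ℂ, E ⊆ closedBall c r}

/-- The local circumradii of `K_h`, that is, the circumradii of its nests. -/
def localCircumradii (ρ : ℝ) (h : ℝ → ℝ) : Set ℝ :=
  {R | ∃ α : ℝ, IsNest ρ h α ∧ R = circumradius (arc ρ h α)}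

/-- `R*_loc`, the supremum of the local circumradii of `K_h`. -/
def maxLocalCircumradius (ρ : ℝ) (h : ℝ → ℝ) : ℝ := sSup (localCircumradii ρ h)

/-- For a bounded non-empty set the smallest closed disk exists, and its radius is
`circumradius E`. -/
theorem circumradius_isLeast {E : Set ℂ} (hne : E.Nonempty) (hb : Bornology.IsBounded E) :
    IsLeast {r : ℝ | 0 ≤ r ∧ ∃ c : ℂ, E ⊆ closedBall c r} (circumradius E) := by
  obtain ⟨e, he⟩ := hne
  obtain ⟨M, hM⟩ := hb.subset_closedBall e
  have hM0 : 0 ≤ M := dist_nonneg.trans (hM he)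
  have hproj : {r : ℝ | 0 ≤ r ∧ ∃ c : ℂ, E ⊆ closedBall c r} ∩ Iic M =
      Prod.snd '' ({p : ℂ × ℝ | ∀ z ∈ E, dist z p.1 ≤ p.2} ∩ closedBall e M ×ˢ Icc 0 M) := by
    ext r
    constructor
    · rintro ⟨⟨h0, c, hc⟩, hr⟩
      refine ⟨(c, r), ⟨fun z hz => hc hz, ?_, h0, hr⟩, rfl⟩
      have := hc he
      rw [mem_closedBall, dist_comm] at this
      exact mem_closedBall.2 (this.trans hr)
    · rintro ⟨⟨c, r'⟩, ⟨h1, -, h0, hr⟩, rfl⟩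
      exact ⟨⟨h0, c, fun z hz => h1 z hz⟩, hr⟩
  have hcl : IsClosed {p : ℂ × ℝ | ∀ z ∈ E, dist z p.1 ≤ p.2} := by
    simp only [ofPred_forall]
    exact isClosed_biInter fun z _ =>
      isClosed_le (continuous_const.dist continuous_fst) continuous_snd
  have hcomp : IsCompact ({r : ℝ | 0 ≤ r ∧ ∃ c : ℂ, E ⊆ closedBall c r} ∩ Iic M) := by
    rw [hproj]
    exact (((isCompact_closedBall e M).prod isCompact_Icc).inter_left hcl).image continuous_snd
  obtain ⟨r, ⟨hr, hrM⟩, hmin⟩ := hcomp.exists_isLeast ⟨M, ⟨hM0, e, hM⟩, le_refl M⟩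
  have hl : IsLeast {r : ℝ | 0 ≤ r ∧ ∃ c : ℂ, E ⊆ closedBall c r} r := by
    refine ⟨hr, fun s hs => ?_⟩
    rcases le_total s M with h | h
    · exact hmin ⟨hs, h⟩
    · exact le_trans hrM h
  have : circumradius E = r := hl.csInf_eq
  rwa [this]

/-- A `ρ`-trigonometrically convex function is bounded. -/
theorem TC.bounded {ρ : ℝ} (hρ : 0 < ρ) {h : ℝ → ℝ} (hh : TC ρ h) : ∃ M : ℝ, ∀ t, |h t| ≤ M := by
  have hpi := Real.pi_pos
  have key : ∃ M : ℝ, ∀ t ∈ Icc (0 : ℝ) (2 * Real.pi), |h t| ≤ M := by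
    refine isCompact_Icc.induction_on (p := fun S => ∃ M : ℝ, ∀ t ∈ S, |h t| ≤ M) ⟨0, by simp⟩
      (fun S T hST ⟨M, hM⟩ => ⟨M, fun t ht => hM t (hST ht)⟩)
      (fun S T ⟨M, hM⟩ ⟨N, hN⟩ => ⟨max M N, fun t ht => ht.elim
        (fun h => (hM t h).trans (le_max_left _ _)) (fun h => (hN t h).trans (le_max_right _ _))⟩) ?_
    intro t₀ _
    obtain ⟨δ, hδ⟩ : ∃ δ, δ = Real.pi / (4 * ρ) := ⟨_, rfl⟩
    have hδ0 : 0 < δ := by rw [hδ]; positivity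
    have hρδ : ρ * δ = Real.pi / 4 := by rw [hδ]; field_simp
    have h4 : Real.pi / ρ = 4 * δ := by rw [hδ]; field_simp
    have hs : 0 < Real.sin (Real.pi / 4) :=
      Real.sin_pos_of_pos_of_lt_pi (by linarith) (by linarith)
    refine ⟨Ioo (t₀ - δ) (t₀ + δ), mem_nhdsWithin_of_mem_nhds
      (Ioo_mem_nhds (by linarith) (by linarith)),
      (|h (t₀ - δ)| + |h (t₀ + δ)|) + (|h (t₀ - 2 * δ)| + |h (t₀ - δ)|) / Real.sin (Real.pi / 4),
      fun t ht => ?_⟩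
    have bd : ∀ a b : ℝ, |a * Real.sin b| ≤ |a| := fun a b => by
      rw [abs_mul]; exact mul_le_of_le_one_right (abs_nonneg _) (Real.abs_sin_le_one _)
    have up := hh.ineq (t₀ - δ) t (t₀ + δ) ht.1 ht.2 (by rw [h4]; linarith)
    have lo := hh.ineq (t₀ - 2 * δ) (t₀ - δ) t (by linarith) ht.1 (by rw [h4]; linarith [ht.2])
    have e1 : ρ * (t₀ + δ - (t₀ - δ)) = Real.pi / 2 := by linear_combination 2 * hρδ
    have e2 : ρ * (t₀ - 2 * δ - (t₀ - δ)) = -(Real.pi / 4) := by linear_combination -hρδ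
    rw [e1, Real.sin_pi_div_two] at up
    rw [e2, Real.sin_neg] at lo
    have b1 := abs_le.1 (bd (h (t₀ - δ)) (ρ * (t - (t₀ + δ))))
    have b2 := abs_le.1 (bd (h (t₀ + δ)) (ρ * (t₀ - δ - t)))
    have b3 := abs_le.1 (bd (h (t₀ - 2 * δ)) (ρ * (t₀ - δ - t)))
    have b4 := abs_le.1 (bd (h (t₀ - δ)) (ρ * (t - (t₀ - 2 * δ))))
    have n1 : 0 ≤ (|h (t₀ - 2 * δ)| + |h (t₀ - δ)|) / Real.sin (Real.pi / 4) := by positivity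
    have n2 : 0 ≤ |h (t₀ - δ)| + |h (t₀ + δ)| := by positivity
    have hlow : -((|h (t₀ - 2 * δ)| + |h (t₀ - δ)|) / Real.sin (Real.pi / 4)) ≤ h t := by
      rw [← neg_div, div_le_iff₀ hs]
      linarith
    exact abs_le.2 ⟨by linarith, by linarith⟩
  obtain ⟨M, hM⟩ := key
  refine ⟨M, fun t => ?_⟩
  obtain ⟨y, hy, e⟩ := hh.periodic.exists_mem_Ico₀ (by positivity) t
  rw [e]
  exact hM y (Ico_subset_Icc_self hy)

/-- Every subarc of `K_h`, and so the whole curve, is bounded. -/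
theorem TC.isBounded_subarc {ρ : ℝ} (hρ : 0 < ρ) {h : ℝ → ℝ} (hh : TC ρ h) (I : Set ℝ) :
    Bornology.IsBounded (subarc ρ h I) := by
  obtain ⟨M, hM⟩ := hh.bounded hρ
  have hpi := Real.pi_pos
  refine (isBounded_iff_forall_norm_le).2 ⟨2 * M, fun z hz => ?_⟩
  simp only [subarc, mem_iUnion] at hz
  obtain ⟨t, -, h1, h2⟩ := hz
  simp only [mem_iInter] at h2
  have a1 := h2 (t + Real.pi / 2) ⟨by linarith, by linarith⟩
  have a2 := h2 (t - Real.pi / 2) ⟨by linarith, by linarith⟩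
  simp only [halfPlane, supportLine, mem_ofPred_eq, stretch, Real.cos_add_pi_div_two,
    Real.sin_add_pi_div_two, Real.cos_sub_pi_div_two, Real.sin_sub_pi_div_two] at a1 a2 h1
  have m1 := abs_le.1 (hM (t / ρ))
  have m2 := abs_le.1 (hM ((t + Real.pi / 2) / ρ))
  have m3 := abs_le.1 (hM ((t - Real.pi / 2) / ρ))
  have hM0 : 0 ≤ M := (abs_nonneg _).trans (hM 0)
  have q1 : (z.re * Real.cos t + z.im * Real.sin t) ^ 2 ≤ M ^ 2 :=
    sq_le_sq' (by linarith) (by linarith)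
  have q2 : (z.im * Real.cos t - z.re * Real.sin t) ^ 2 ≤ M ^ 2 :=
    sq_le_sq' (by linarith) (by linarith)
  have hn : ‖z‖ ^ 2 = z.re ^ 2 + z.im ^ 2 := by
    rw [Complex.sq_norm, Complex.normSq_apply]; ring
  have e : z.re ^ 2 + z.im ^ 2 = (z.re * Real.cos t + z.im * Real.sin t) ^ 2 +
      (z.im * Real.cos t - z.re * Real.sin t) ^ 2 := by
    linear_combination -(z.re ^ 2 + z.im ^ 2) * Real.sin_sq_add_cos_sq t
  refine le_of_sq_le_sq ?_ (by linarith)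
  nlinarith

end TrigConvex

end

/-!
Write `g t = h (t / ρ)`. It is trigonometrically convex of index `1` on the whole line
(`IsTrigConvex`) and `2πρ`-periodic. For a level `R`, a *minorant* is a periodic trigonometrically
convex `τ` with `g + τ ≤ R`. The theorem follows from one fact: the lowest level `R` that admits a
minorant is the greatest circumradius of a nest.

No nest has a larger circumradius (`IsNest.circumradius_le`). A supporting sinusoid of `τ` at
`α - π` stays below `τ` on all of `[α - 2π, α]`, so `g` is at most `R` minus a sinusoid there, and
such a sinusoid is `t ↦ x cos t + y sin t` for a point `(x, y)`: this is the center of a disk of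
radius `R`. By the nest condition, the `2π`-periodic extension of `g` from `[α - 2π, α]` is the
support function of a convex body containing `N_α` (`IsNest.proj_le`), so the disk contains `N_α`.

Some nest has circumradius at least `R` (`TC.exists_extremal_nest`). The lowest level exists by
compactness (`exists_least_level`). At that level some point `t₀` is a contact point, `g + τ = R`,
for every minorant `τ`; otherwise an average of finitely many minorants would have no contact
(`exists_forced_contact`). Let `τ` be the greatest minorant.
* It cannot be raised where there is no contact. Hence every interval of length `π` has a contact
  point, and `τ` is a sinusoid on intervals without contact (`IsGreatestMinorant.exists_contact`,
  `IsGreatestMinorant.eq_chord`).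
* It cannot be lowered at `t₀`. Hence the maximal interval around `t₀` on which `τ` is a sinusoid
  has length at least `π`; otherwise `τ` could be replaced, between two points just outside this
  interval, by the maximum of the supporting sinusoids there (`IsMinorant.sinusoid_near_forced`).

Together they give contact points `s`, `e` with `s + π ≤ e < s + 2π` such that `τ` is a sinusoid on
`[s, e]` (`IsGreatestMinorant.exists_sinusoidal_interval`). Comparing `τ` with this sinusoid beyond
`[s, e]` shows that `g - g (· - 2π)` is nonnegative at `e` and nonpositive at `s + 2π`. It changes
sign at some `α` between them, and there the nest condition holds
(`IsTrigConvex.exists_crossing`). Since the contact points in `[s, e]` meet every half-circle of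
directions, no disk of radius less than `R` contains `N_α` (`le_circumradius`).
-/

noncomputable section

namespace TrigConvex

open Filter Topology Real

/-! ### Trigonometrically convex functions: slopes, supporting sinusoids, locality -/

/-- Trigonometric convexity of index `1` on the whole line, in the form of a three-point inequality
around the middle point. -/
def IsTrigConvex (f : ℝ → ℝ) : Prop :=
  ∀ t a b : ℝ, 0 < a → 0 < b → a + b < π →
    f t * sin (a + b) ≤ f (t - a) * sin b + f (t + b) * sin a

/-- The sinusoid with value `f t` and slope `y` at `t` lies below `f` on `[t - π, t + π]`. -/
def Supports (f : ℝ → ℝ) (t y : ℝ) : Prop :=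
  ∀ s : ℝ, |s| ≤ π → f t * cos s + y * sin s ≤ f (t + s)

theorem IsTrigConvex.neg_arg {f : ℝ → ℝ} (hf : IsTrigConvex f) :
    IsTrigConvex fun x => f (-x) := by
  intro t a b ha hb hab
  have := hf (-t) b a hb ha (by linarith)
  rw [add_comm b a] at this
  have e1 : -(t - a) = -t + a := by ring
  have e2 : -(t + b) = -t - b := by ring
  simp only [e1, e2]
  linarith

theorem IsTrigConvex.add_arg {f : ℝ → ℝ} (hf : IsTrigConvex f) (c : ℝ) :
    IsTrigConvex fun x => f (x + c) := by
  intro t a b ha hb hab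
  have := hf (t + c) a b ha hb hab
  have e1 : t - a + c = t + c - a := by ring
  have e2 : t + b + c = t + c + b := by ring
  simp only [e1, e2]
  exact this

/-- The slope at `t` of the sinusoid through `(t, f t)` and `(t + s, f (t + s))`. -/
def trigSlope (f : ℝ → ℝ) (t s : ℝ) : ℝ := (f (t + s) - f t * cos s) / sin s

theorem IsTrigConvex.trigSlope_monotoneOn {f : ℝ → ℝ} (hf : IsTrigConvex f) (t : ℝ) :
    MonotoneOn (trigSlope f t) (Ioo 0 π) := by
  intro a ha b hb hab
  rcases hab.eq_or_lt with rfl | hab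
  · exact le_rfl
  have h1 := hf (t + a) a (b - a) ha.1 (by linarith) (by linarith [hb.2])
  have e1 : t + a - a = t := by ring
  have e2 : t + a + (b - a) = t + b := by ring
  have e3 : a + (b - a) = b := by ring
  rw [e1, e2, e3, sin_sub] at h1
  have sa := sin_pos_of_mem_Ioo ha
  have sb := sin_pos_of_mem_Ioo hb
  unfold trigSlope
  rw [div_le_div_iff₀ sa sb]
  linarith

/-- Slopes on the left of `t` (slopes of the reflected function, up to sign) are at most slopes on
the right. -/
theorem IsTrigConvex.neg_trigSlope_le {f : ℝ → ℝ} (hf : IsTrigConvex f) (t : ℝ) {a b : ℝ}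
    (ha : a ∈ Ioo 0 π) (hb : b ∈ Ioo 0 π) :
    -trigSlope (fun x => f (-x)) (-t) a ≤ trigSlope f t b := by
  have key : ∀ a ∈ Ioo 0 π, ∀ b ∈ Ioo 0 π, a + b < π →
      -trigSlope (fun x => f (-x)) (-t) a ≤ trigSlope f t b := by
    intro a ha b hb hab
    have sa := sin_pos_of_mem_Ioo ha
    have sb := sin_pos_of_mem_Ioo hb
    have h1 := hf t a b ha.1 hb.1 hab
    have e : -(-t + a) = t - a := by ring
    simp only [trigSlope, e, neg_neg]
    rw [← neg_div, div_le_div_iff₀ sa sb]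
    rw [sin_add] at h1
    linarith
  have hc : min a ((π - b) / 2) ∈ Ioo 0 π :=
    ⟨lt_min ha.1 (by linarith [hb.2]), (min_le_left _ _).trans_lt ha.2⟩
  refine le_trans (neg_le_neg ?_) (key _ hc b hb ?_)
  · exact hf.neg_arg.trigSlope_monotoneOn (-t) hc ha (min_le_left _ _)
  · linarith [min_le_right a ((π - b) / 2), hb.2]

/-- A trigonometrically convex function has a right derivative, the infimum of its trigonometric
slopes. -/
theorem IsTrigConvex.exists_rightDeriv {f : ℝ → ℝ} (hf : IsTrigConvex f) (t : ℝ) :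
    ∃ r : ℝ, HasDerivWithinAt f r (Ici t) t ∧ IsGLB (trigSlope f t '' Ioo 0 π) r := by
  have hpi := pi_pos
  have hmid : π / 2 ∈ Ioo 0 π := ⟨by linarith, by linarith⟩
  have hbdd : BddBelow (trigSlope f t '' Ioo 0 π) :=
    ⟨-trigSlope (fun x => f (-x)) (-t) (π / 2), by
      rintro _ ⟨b, hb, rfl⟩
      exact hf.neg_trigSlope_le t hmid hb⟩
  have hne : (trigSlope f t '' Ioo 0 π).Nonempty := ⟨_, mem_image_of_mem _ hmid⟩
  refine ⟨sInf (trigSlope f t '' Ioo 0 π), ?_, isGLB_csInf hne hbdd⟩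
  have hlim : Tendsto (trigSlope f t) (𝓝[>] 0) (𝓝 (sInf (trigSlope f t '' Ioo 0 π))) :=
    (hf.trigSlope_monotoneOn t).tendsto_nhdsWithin_Ioo_right ⟨_, hmid⟩ hbdd
  have hcos : Tendsto (fun s : ℝ => s⁻¹ * (cos s - 1)) (𝓝[>] 0) (𝓝 0) := by
    have := (hasDerivAt_cos 0).hasDerivWithinAt (s := Ioi 0)
    rw [hasDerivWithinAt_iff_tendsto_slope' (by simp)] at this
    simp only [sin_zero, neg_zero] at this
    exact this.congr fun s => by simp [slope_def_field, div_eq_inv_mul]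
  have hsin : Tendsto (fun s : ℝ => s⁻¹ * sin s) (𝓝[>] 0) (𝓝 1) := by
    have := (hasDerivAt_sin 0).hasDerivWithinAt (s := Ioi 0)
    rw [hasDerivWithinAt_iff_tendsto_slope' (by simp)] at this
    simp only [cos_zero] at this
    exact this.congr fun s => by simp [slope_def_field, div_eq_inv_mul]
  have hcomp : HasDerivWithinAt (fun s => f (t + s))
      (sInf (trigSlope f t '' Ioo 0 π)) (Ioi 0) 0 := by
    rw [hasDerivWithinAt_iff_tendsto_slope' (by simp)]
    have h2 := ((hcos.const_mul (f t)).add (hlim.mul hsin))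
    rw [mul_zero, zero_add, mul_one] at h2
    refine h2.congr' ?_
    filter_upwards [Ioo_mem_nhdsGT hpi] with s hs
    have ss := (sin_pos_of_mem_Ioo hs).ne'
    have s0 := hs.1.ne'
    simp only [slope_def_field, trigSlope, add_zero, sub_zero]
    field_simp
    ring
  rw [← hasDerivWithinAt_Ioi_iff_Ici]
  have h3 : HasDerivWithinAt (fun x : ℝ => x - t) 1 (Ioi t) t :=
    ((hasDerivAt_id t).sub_const t).hasDerivWithinAt
  have h4 := HasDerivWithinAt.scomp_of_eq t hcomp h3 (fun x hx => by simpa using hx) (by simp)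
  simpa [Function.comp_def] using h4

/-- One-sided derivatives exist and are ordered, and the sinusoids with these slopes lie below the
function on their side. -/
theorem IsTrigConvex.exists_derivs {f : ℝ → ℝ} (hf : IsTrigConvex f) (t : ℝ) :
    ∃ l r : ℝ, HasDerivWithinAt f l (Iic t) t ∧ HasDerivWithinAt f r (Ici t) t ∧ l ≤ r ∧
      ∀ a ∈ Ioo 0 π, f t * cos a + r * sin a ≤ f (t + a) ∧
        f t * cos a - l * sin a ≤ f (t - a) := by
  obtain ⟨r, hr, hr'⟩ := hf.exists_rightDeriv t
  obtain ⟨l, hl, hl'⟩ := hf.neg_arg.exists_rightDeriv (-t)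
  refine ⟨-l, r, ?_, hr, ?_, fun a ha => ⟨?_, ?_⟩⟩
  · have h3 : HasDerivWithinAt (fun x : ℝ => -x) (-1) (Iic t) t :=
      (hasDerivAt_neg t).hasDerivWithinAt
    have h4 := HasDerivWithinAt.scomp t hl h3 (fun x hx => by simpa using hx)
    simpa [Function.comp_def] using h4
  · refine hr'.2 ?_
    rintro _ ⟨b, hb, rfl⟩
    refine neg_le.1 (hl'.2 ?_)
    rintro _ ⟨a, ha, rfl⟩
    exact neg_le.1 (hf.neg_trigSlope_le t ha hb)
  · have := hr'.1 (mem_image_of_mem _ ha)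
    rw [trigSlope, le_div_iff₀ (sin_pos_of_mem_Ioo ha)] at this
    linarith
  · have := hl'.1 (mem_image_of_mem _ ha)
    have e : -(-t + a) = t - a := by ring
    rw [trigSlope, le_div_iff₀ (sin_pos_of_mem_Ioo ha)] at this
    simp only [e, neg_neg] at this
    linarith

theorem IsTrigConvex.continuous {f : ℝ → ℝ} (hf : IsTrigConvex f) : Continuous f := by
  refine continuous_iff_continuousAt.2 fun t => continuousAt_iff_continuous_left_right.2 ?_
  obtain ⟨l, r, hl, hr, -⟩ := hf.exists_derivs t
  exact ⟨hl.continuousWithinAt, hr.continuousWithinAt⟩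

theorem le_of_le_Ioo {u v : ℝ → ℝ} (hu : Continuous u) (hv : Continuous v) {a b : ℝ} (hab : a < b)
    (h : ∀ s ∈ Ioo a b, u s ≤ v s) : ∀ s ∈ Icc a b, u s ≤ v s := by
  intro s hs
  rw [← closure_Ioo hab.ne] at hs
  exact closure_minimal (fun s hs => h s hs) (isClosed_le hu hv) hs

theorem IsTrigConvex.supports_of_Ioo {f : ℝ → ℝ} (hf : IsTrigConvex f) {t y : ℝ}
    (h : ∀ a ∈ Ioo 0 π, f t * cos a + y * sin a ≤ f (t + a) ∧
        f t * cos a - y * sin a ≤ f (t - a)) : Supports f t y := by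
  intro s hs
  have hpi := pi_pos
  have hc := hf.continuous
  refine le_of_le_Ioo (u := fun s => f t * cos s + y * sin s) (v := fun s => f (t + s))
    (by fun_prop) (by fun_prop) (a := -π) (b := π) (by linarith) ?_ s (abs_le.1 hs)
  intro s hs
  rcases lt_trichotomy s 0 with h0 | rfl | h0
  · have := (h (-s) ⟨by linarith, by linarith [hs.1]⟩).2
    simpa using this
  · simp
  · exact (h s ⟨h0, hs.2⟩).1

theorem IsTrigConvex.exists_supports {f : ℝ → ℝ} (hf : IsTrigConvex f) (t : ℝ) :
    ∃ y, Supports f t y := by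
  obtain ⟨l, r, hl, hr, hlr, h⟩ := hf.exists_derivs t
  refine ⟨r, hf.supports_of_Ioo fun a ha => ⟨(h a ha).1, le_trans ?_ (h a ha).2⟩⟩
  have := mul_le_mul_of_nonneg_right hlr (sin_pos_of_mem_Ioo ha).le
  linarith

/-- The case `s = π` of a supporting sinusoid. In particular, this bounds minorants from below. -/
theorem IsTrigConvex.antipodal {f : ℝ → ℝ} (hf : IsTrigConvex f) (t : ℝ) :
    0 ≤ f t + f (t + π) := by
  obtain ⟨y, hy⟩ := hf.exists_supports t
  have := hy π (by rw [abs_of_pos pi_pos])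
  simp at this
  linarith

/-- Trigonometric convexity is a local property: a continuous function that has a supporting
sinusoid near each point is trigonometrically convex. -/
theorem isTrigConvex_of_local {f : ℝ → ℝ} (hc : Continuous f)
    (h : ∀ t, ∃ y, ∀ᶠ s in 𝓝 (0 : ℝ), f t * cos s + y * sin s ≤ f (t + s)) :
    IsTrigConvex f := by
  intro t a b ha hb hab
  by_contra! hlt
  have hS : 0 < sin (a + b) := sin_pos_of_pos_of_lt_pi (by linarith) hab
  -- With `χ` the chord and `w` a positive sinusoid on `[-a, b]`, the maximum principle applies to
  -- `u = (f (t + ·) - χ) / w`: at its leftmost maximum there is no supporting sinusoid.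
  obtain ⟨χ, hχ⟩ : ∃ χ : ℝ → ℝ, χ = fun x =>
      (f (t - a) * sin (b - x) + f (t + b) * sin (a + x)) / sin (a + b) := ⟨_, rfl⟩
  obtain ⟨w, hw⟩ : ∃ w : ℝ → ℝ, w = fun x => cos (x - (b - a) / 2) := ⟨_, rfl⟩
  have hwpos : ∀ x ∈ Icc (-a) b, 0 < w x := fun x hx => by
    rw [hw]
    exact cos_pos_of_mem_Ioo ⟨by linarith [hx.1], by linarith [hx.2]⟩
  have hχa : ∀ x s, χ (x + s) = χ x * cos s +
      (-f (t - a) * cos (b - x) + f (t + b) * cos (a + x)) / sin (a + b) * sin s := by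
    intro x s
    have e1 : b - (x + s) = (b - x) - s := by ring
    have e2 : a + (x + s) = (a + x) + s := by ring
    simp only [hχ, e1, e2, sin_sub (b - x) s, sin_add (a + x) s]
    ring
  have hwa : ∀ x s, w (x + s) = w x * cos s - sin (x - (b - a) / 2) * sin s := by
    intro x s
    have e1 : x + s - (b - a) / 2 = x - (b - a) / 2 + s := by ring
    simp only [hw, e1, cos_add]
  have hχc : Continuous χ := by rw [hχ]; fun_prop
  have hwc : Continuous w := by rw [hw]; fun_prop
  obtain ⟨u, hu⟩ : ∃ u : ℝ → ℝ, u = fun x => (f (t + x) - χ x) / w x := ⟨_, rfl⟩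
  have huc : ContinuousOn u (Icc (-a) b) := by
    rw [hu]
    exact ContinuousOn.div (by fun_prop) hwc.continuousOn fun x hx => (hwpos x hx).ne'
  have hfu : ∀ x ∈ Icc (-a) b, f (t + x) = χ x + u x * w x := fun x hx => by
    have := (hwpos x hx).ne'
    rw [hu]; field_simp; ring
  have h0m : (0 : ℝ) ∈ Icc (-a) b := ⟨by linarith, hb.le⟩
  have hua : u (-a) = 0 := by
    have e : b - -a = a + b := by ring
    have e' : t + -a = t - a := by ring
    simp only [hu, hχ, e, e', add_neg_cancel, sin_zero, mul_zero, add_zero]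
    field_simp; simp
  have hub : u b = 0 := by
    simp only [hu, hχ, sub_self, sin_zero, mul_zero, zero_add]
    field_simp; simp
  have hu0 : 0 < u 0 := by
    have hw0 := hwpos 0 h0m
    simp only [hu, hχ, sub_zero, add_zero]
    refine div_pos ?_ hw0
    rw [sub_pos, div_lt_iff₀ hS]
    linarith
  obtain ⟨m, hm, hmax⟩ := isCompact_Icc.exists_isMaxOn ⟨0, h0m⟩ huc
  have hcl : IsCompact (Icc (-a) b ∩ u ⁻¹' {u m}) :=
    isCompact_Icc.of_isClosed_subset
      (huc.preimage_isClosed_of_isClosed isClosed_Icc isClosed_singleton) inter_subset_left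
  obtain ⟨x, ⟨hx, hxm⟩, hleast⟩ := hcl.exists_isLeast ⟨m, hm, rfl⟩
  have hxm : u x = u m := hxm
  have hum : 0 < u x := by rw [hxm]; exact hu0.trans_le (hmax h0m)
  have hxa : -a < x := lt_of_le_of_ne hx.1 fun e => by rw [← e, hua] at hum; exact hum.false
  have hxb : x < b := lt_of_le_of_ne hx.2 fun e => by rw [e, hub] at hum; exact hum.false
  obtain ⟨y, hy⟩ := h (t + x)
  obtain ⟨ε, hε, hy⟩ := Metric.eventually_nhds_iff.1 hy
  obtain ⟨δ, hδ0, hδ1⟩ := exists_between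
    (lt_min (lt_min hε pi_pos) (lt_min (sub_pos.2 hxa) (sub_pos.2 hxb)))
  rw [lt_min_iff, lt_min_iff, lt_min_iff] at hδ1
  obtain ⟨⟨hδε, hδπ⟩, hδa, hδb⟩ := hδ1
  have hsd : 0 < sin δ := sin_pos_of_pos_of_lt_pi hδ0 hδπ
  have key : ∀ s, |s| < ε → x + s ∈ Icc (-a) b →
      u x * w (x + s) + (y - (-f (t - a) * cos (b - x) + f (t + b) * cos (a + x)) / sin (a + b)
        + u x * sin (x - (b - a) / 2)) * sin s ≤ u (x + s) * w (x + s) := by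
    intro s hs hxs
    have h1 := hy (y := s) (by simpa using hs)
    rw [add_assoc, hfu x hx, hfu _ hxs, hχa] at h1
    have := hwa x s
    rw [this] at h1 ⊢
    linarith
  have hp := key δ (by rwa [abs_of_pos hδ0]) ⟨by linarith, by linarith⟩
  have hn := key (-δ) (by rwa [abs_neg, abs_of_pos hδ0]) ⟨by linarith, by linarith⟩
  have mp : x + δ ∈ Icc (-a) b := ⟨by linarith, by linarith⟩
  have mn : x + -δ ∈ Icc (-a) b := ⟨by linarith, by linarith⟩
  have up : u (x + δ) ≤ u x := by rw [hxm]; exact hmax mp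
  have un : u (x + -δ) ≤ u x := by rw [hxm]; exact hmax mn
  have up' := mul_le_mul_of_nonneg_right up (hwpos _ mp).le
  have un' := mul_le_mul_of_nonneg_right un (hwpos _ mn).le
  rw [sin_neg] at hn
  have hY0 : (y - (-f (t - a) * cos (b - x) + f (t + b) * cos (a + x)) / sin (a + b)
        + u x * sin (x - (b - a) / 2)) * sin δ = 0 := by
    refine le_antisymm (by linarith) (by linarith)
  have : u x ≤ u (x + -δ) := le_of_mul_le_mul_right (by linarith) (hwpos _ mn)
  have := hleast ⟨mn, (un.antisymm this).trans hxm⟩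
  linarith

/-! ### Sinusoids and gluing -/

/-- The sinusoid with value `A` and slope `B` at `c`. -/
def sinusoid (A B c x : ℝ) : ℝ := A * cos (x - c) + B * sin (x - c)

theorem continuous_sinusoid (A B c : ℝ) : Continuous (sinusoid A B c) := by
  unfold sinusoid; fun_prop

theorem sinusoid_add (A B c x s : ℝ) : sinusoid A B c (x + s) =
    sinusoid A B c x * cos s + (B * cos (x - c) - A * sin (x - c)) * sin s := by
  have e : x + s - c = (x - c) + s := by ring
  simp only [sinusoid, e, cos_add, sin_add]
  ring

theorem sinusoid_self (A B c : ℝ) : sinusoid A B c c = A := by simp [sinusoid]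

/-- Sinusoids satisfy the three-point relation with equality. -/
theorem sinusoid_three_point (A B c t a b : ℝ) :
    sinusoid A B c t * sin (a + b) =
      sinusoid A B c (t - a) * sin b + sinusoid A B c (t + b) * sin a := by
  rw [sub_eq_add_neg, sinusoid_add, sinusoid_add, sin_neg, cos_neg, sin_add]
  ring

theorem isTrigConvex_sinusoid (A B c : ℝ) : IsTrigConvex (sinusoid A B c) :=
  fun t a b _ _ _ => (sinusoid_three_point A B c t a b).le

theorem isTrigConvex_zero : IsTrigConvex fun _ => 0 := fun _ _ _ _ _ _ => by simp

theorem IsTrigConvex.add {f g : ℝ → ℝ} (hf : IsTrigConvex f) (hg : IsTrigConvex g) :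
    IsTrigConvex fun x => f x + g x := by
  intro t a b ha hb hab
  have := hf t a b ha hb hab
  have := hg t a b ha hb hab
  dsimp only
  linarith

theorem IsTrigConvex.const_mul {f : ℝ → ℝ} (hf : IsTrigConvex f) {c : ℝ} (hc : 0 ≤ c) :
    IsTrigConvex fun x => c * f x := by
  intro t a b ha hb hab
  have := mul_le_mul_of_nonneg_left (hf t a b ha hb hab) hc
  dsimp only
  linarith

theorem IsTrigConvex.max {f g : ℝ → ℝ} (hf : IsTrigConvex f) (hg : IsTrigConvex g) :
    IsTrigConvex fun x => max (f x) (g x) := by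
  intro t a b ha hb hab
  have sa : 0 ≤ sin a := (sin_pos_of_pos_of_lt_pi ha (by linarith)).le
  have sb : 0 ≤ sin b := (sin_pos_of_pos_of_lt_pi hb (by linarith)).le
  have sab : 0 ≤ sin (a + b) := (sin_pos_of_pos_of_lt_pi (by linarith) hab).le
  dsimp only
  rw [max_mul_of_nonneg _ _ sab]
  refine max_le ((hf t a b ha hb hab).trans ?_) ((hg t a b ha hb hab).trans ?_)
  · gcongr <;> exact le_max_left _ _
  · gcongr <;> exact le_max_right _ _

theorem Supports.sinusoid_le {f : ℝ → ℝ} {t y : ℝ} (h : Supports f t y) {x : ℝ}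
    (hx : |x - t| ≤ π) : sinusoid (f t) y t x ≤ f x := by
  have := h (x - t) hx
  rwa [add_sub_cancel] at this

/-- Two sinusoids that agree at two points less than `π` apart are equal. -/
theorem sinusoid_ext {A B c A' B' c' a b : ℝ} (hlt : a < b) (hab : b - a < π)
    (ha : sinusoid A B c a = sinusoid A' B' c' a) (hb : sinusoid A B c b = sinusoid A' B' c' b)
    (x : ℝ) : sinusoid A B c x = sinusoid A' B' c' x := by
  have hS : 0 < sin (b - a) := sin_pos_of_pos_of_lt_pi (by linarith) hab
  have h1 := sinusoid_add A B c a (b - a)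
  have h2 := sinusoid_add A' B' c' a (b - a)
  rw [add_sub_cancel] at h1 h2
  rw [h1, h2, ha, add_right_inj] at hb
  have h3 := mul_right_cancel₀ hS.ne' hb
  have h4 := sinusoid_add A B c a (x - a)
  have h5 := sinusoid_add A' B' c' a (x - a)
  rw [add_sub_cancel] at h4 h5
  rw [h4, h5, ha, h3]

/-- A sinusoid through two points of the graph lies above it between these points. -/
theorem IsTrigConvex.le_sinusoid {f : ℝ → ℝ} (hf : IsTrigConvex f) {A B c a b : ℝ}
    (hlt : a < b) (hab : b - a < π) (ha : sinusoid A B c a = f a) (hb : sinusoid A B c b = f b) :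
    ∀ t ∈ Icc a b, f t ≤ sinusoid A B c t := by
  have hS : 0 < sin (b - a) := sin_pos_of_pos_of_lt_pi (by linarith) hab
  intro t ht
  rcases ht.1.eq_or_lt with rfl | h1
  · exact ha.ge
  rcases ht.2.eq_or_lt with rfl | h2
  · exact hb.ge
  have e1 : t - a + (b - t) = b - a := by ring
  have e2 : t - (t - a) = a := by ring
  have e3 : t + (b - t) = b := by ring
  have k1 := hf t (t - a) (b - t) (by linarith) (by linarith) (by linarith)
  have k2 := sinusoid_three_point A B c t (t - a) (b - t)
  rw [e1, e2, e3] at k1 k2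
  rw [ha, hb] at k2
  exact le_of_mul_le_mul_right (k1.trans_eq k2.symm) hS

/-- A sinusoid through two points of the graph lies below it to the left of these points. -/
theorem IsTrigConvex.sinusoid_le_left {f : ℝ → ℝ} (hf : IsTrigConvex f) {A B c a b : ℝ}
    (hlt : a < b) (hab : b - a < π) (ha : sinusoid A B c a = f a) (hb : sinusoid A B c b = f b)
    (s : ℝ) (hs : |s| ≤ π) (h0 : s ≤ 0) : sinusoid A B c (a + s) ≤ f (a + s) := by
  have hS : 0 < sin (b - a) := sin_pos_of_pos_of_lt_pi (by linarith) hab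
  obtain ⟨y, hy⟩ := hf.exists_supports a
  have h1 := hy (b - a) (abs_le.2 ⟨by linarith [pi_pos], hab.le⟩)
  have h2 := sinusoid_add A B c a (b - a)
  rw [add_sub_cancel] at h1 h2
  rw [ha, hb] at h2
  have h3 : y ≤ B * cos (a - c) - A * sin (a - c) := le_of_mul_le_mul_right (by linarith) hS
  have hs0 : sin s ≤ 0 := sin_nonpos_of_nonpos_of_neg_pi_le h0 (abs_le.1 hs).1
  have h4 := mul_le_mul_of_nonpos_right h3 hs0
  have := hy s hs
  rw [sinusoid_add, ha]
  linarith

/-- A sinusoid through two points of the graph lies below it to the right of these points. -/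
theorem IsTrigConvex.sinusoid_le_right {f : ℝ → ℝ} (hf : IsTrigConvex f) {A B c a b : ℝ}
    (hlt : a < b) (hab : b - a < π) (ha : sinusoid A B c a = f a) (hb : sinusoid A B c b = f b)
    (s : ℝ) (hs : |s| ≤ π) (h0 : 0 ≤ s) : sinusoid A B c (b + s) ≤ f (b + s) := by
  have hS : 0 < sin (b - a) := sin_pos_of_pos_of_lt_pi (by linarith) hab
  obtain ⟨y, hy⟩ := hf.exists_supports b
  have h1 := hy (a - b) (abs_le.2 ⟨by linarith, by linarith [pi_pos]⟩)
  have h2 := sinusoid_add A B c b (a - b)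
  have e : sin (a - b) = -sin (b - a) := by rw [← sin_neg, neg_sub]
  rw [add_sub_cancel, e] at h1 h2
  rw [ha, hb] at h2
  have h3 : B * cos (b - c) - A * sin (b - c) ≤ y := le_of_mul_le_mul_right (by linarith) hS
  have hs0 : 0 ≤ sin s := sin_nonneg_of_nonneg_of_le_pi h0 (abs_le.1 hs).2
  have h4 := mul_le_mul_of_nonneg_right h3 hs0
  have := hy s hs
  rw [sinusoid_add, hb]
  linarith

theorem eventually_abs_le_pi : ∀ᶠ s in 𝓝 (0 : ℝ), |s| ≤ π := by
  filter_upwards [Icc_mem_nhds (neg_lt_zero.2 pi_pos) pi_pos] with s hs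
  exact abs_le.2 hs

theorem isTrigConvex_of_eventuallyEq {f : ℝ → ℝ}
    (h : ∀ t, ∃ g, IsTrigConvex g ∧ f =ᶠ[𝓝 t] g) : IsTrigConvex f := by
  refine isTrigConvex_of_local (continuous_iff_continuousAt.2 fun t => ?_) fun t => ?_
  · obtain ⟨g, hg, he⟩ := h t
    exact hg.continuous.continuousAt.congr he.symm
  · obtain ⟨g, hg, he⟩ := h t
    obtain ⟨y, hy⟩ := hg.exists_supports t
    have ht : Tendsto (fun s => t + s) (𝓝 0) (𝓝 t) := by
      have : Continuous fun s : ℝ => t + s := by fun_prop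
      simpa using this.tendsto 0
    refine ⟨y, ?_⟩
    filter_upwards [ht.eventually he, eventually_abs_le_pi] with s hs hs'
    rw [hs, he.eq_of_nhds]
    exact hy s hs'

/-- A modification of a periodic trigonometrically convex function on an interval shorter than the
period can be repeated periodically. -/
theorem IsTrigConvex.periodize {τ f₀ : ℝ → ℝ} {P a b : ℝ} (hτ : IsTrigConvex τ)
    (hper : Function.Periodic τ P) (hf₀ : IsTrigConvex f₀) (hP : 0 < P) (hab : b - a < P)
    (hle : a ≤ b) (hout : ∀ t, t ∉ Icc a b → f₀ t = τ t) :
    ∃ f : ℝ → ℝ, IsTrigConvex f ∧ Function.Periodic f P ∧ (∀ t ∈ Icc a b, f t = f₀ t) ∧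
      ∀ t, ∃ k : ℤ, f t = f₀ (t - k * P) := by
  -- The fundamental domain `[p, p + P)` has `[a, b]` in its interior, away from the seam.
  obtain ⟨p, hp⟩ : ∃ p, p = a - (P - (b - a)) / 2 := ⟨_, rfl⟩
  have hpa : p < a := by linarith
  have hpb : b < p + P := by linarith
  have hval : ∀ (t : ℝ) (k : ℤ), t - k * P ∈ Ico p (p + P) →
      f₀ (toIcoMod hP p t) = f₀ (t - k * P) := by
    intro t k hk
    rw [(toIcoMod_eq_iff hP).2 ⟨hk, k, by simp⟩]
  have hdiv : ∀ t : ℝ, ∃ k : ℤ, t - k * P ∈ Ico p (p + P) := fun t =>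
    ⟨toIcoDiv hP p t, by simpa using sub_toIcoDiv_zsmul_mem_Ico hP p t⟩
  refine ⟨fun t => f₀ (toIcoMod hP p t), isTrigConvex_of_eventuallyEq fun t => ?_, fun t => ?_,
    fun t ht => ?_, fun t => ?_⟩
  · obtain ⟨k, hk⟩ := hdiv t
    have hcont : ContinuousAt (fun x : ℝ => x - k * P) t := by fun_prop
    rcases hk.1.eq_or_lt with h0 | h0
    · refine ⟨τ, hτ, ?_⟩
      have hnear : ∀ᶠ x in 𝓝 t, x - k * P ∈ Ioo (b - P) a :=
        hcont.eventually (Ioo_mem_nhds (by linarith) (by linarith))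
      filter_upwards [hnear] with x hx
      rcases le_or_gt p (x - k * P) with h1 | h1
      · rw [hval x k ⟨h1, by linarith [hx.2]⟩, hout _ fun h => by linarith [hx.2, h.1],
          hper.sub_int_mul_eq]
      · have hk' : x - ((k - 1 : ℤ) : ℝ) * P = x - k * P + P := by push_cast; ring
        rw [hval x (k - 1) (by rw [hk']; exact ⟨by linarith [hx.1], by linarith⟩),
          hout _ (by rw [hk']; exact fun h => by linarith [hx.1, h.2]), hper.sub_int_mul_eq]
    · refine ⟨fun x => f₀ (x + -(k * P)), hf₀.add_arg _, ?_⟩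
      have hnear : ∀ᶠ x in 𝓝 t, x - k * P ∈ Ioo p (p + P) :=
        hcont.eventually (Ioo_mem_nhds h0 hk.2)
      filter_upwards [hnear] with x hx
      rw [hval x k (Ioo_subset_Ico_self hx), sub_eq_add_neg]
  · simp only [toIcoMod_add_right]
  · have := hval t 0 (by simpa using ⟨by linarith [ht.1], by linarith [ht.2]⟩)
    simpa using this
  · obtain ⟨k, hk⟩ := hdiv t
    exact ⟨k, hval t k hk⟩

/-- Gluing: on `[a, b]` a trigonometrically convex function may be replaced by another one with the
same end values, provided that a supporting sinusoid exists at both ends. -/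
theorem IsTrigConvex.replace {τ φ : ℝ → ℝ} {a b : ℝ} (hτ : IsTrigConvex τ) (hφ : IsTrigConvex φ)
    (hab : a < b) (ha : φ a = τ a) (hb : φ b = τ b)
    (hsa : ∃ y, ∀ s, |s| ≤ π → (s ≤ 0 → τ a * cos s + y * sin s ≤ τ (a + s)) ∧
      (0 ≤ s → τ a * cos s + y * sin s ≤ φ (a + s)))
    (hsb : ∃ y, ∀ s, |s| ≤ π → (s ≤ 0 → τ b * cos s + y * sin s ≤ φ (b + s)) ∧
      (0 ≤ s → τ b * cos s + y * sin s ≤ τ (b + s))) :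
    IsTrigConvex fun t => if t ≤ a then τ t else if t ≤ b then φ t else τ t := by
  have hcτ := hτ.continuous
  have hcφ := hφ.continuous
  have hshift : ∀ t : ℝ, Tendsto (fun s => t + s) (𝓝 0) (𝓝 t) := fun t => by
    have : Continuous fun s : ℝ => t + s := by fun_prop
    simpa using this.tendsto 0
  refine isTrigConvex_of_local ?_ fun t => ?_
  · refine Continuous.if_le hcτ (Continuous.if_le hcφ hcτ continuous_id continuous_const ?_)
      continuous_id continuous_const ?_
    · rintro x rfl; exact hb
    · rintro x rfl; rw [if_pos hab.le, ha]
  rcases lt_trichotomy t a with h | rfl | h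
  · obtain ⟨y, hy⟩ := hτ.exists_supports t
    refine ⟨y, ?_⟩
    filter_upwards [(hshift t).eventually (gt_mem_nhds h), eventually_abs_le_pi] with s hs hs'
    rw [if_pos h.le, if_pos hs.le]
    exact hy s hs'
  · obtain ⟨y, hy⟩ := hsa
    refine ⟨y, ?_⟩
    filter_upwards [(hshift t).eventually (gt_mem_nhds hab), eventually_abs_le_pi] with s hs hs'
    rw [if_pos le_rfl]
    rcases le_or_gt s 0 with h0 | h0
    · rw [if_pos (by linarith)]
      exact (hy s hs').1 h0
    · rw [if_neg (by linarith), if_pos hs.le]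
      exact (hy s hs').2 h0.le
  rcases lt_trichotomy t b with h' | rfl | h'
  · obtain ⟨y, hy⟩ := hφ.exists_supports t
    refine ⟨y, ?_⟩
    filter_upwards [(hshift t).eventually (gt_mem_nhds h'), (hshift t).eventually (lt_mem_nhds h),
      eventually_abs_le_pi] with s hs hs1 hs'
    rw [if_neg h.not_ge, if_pos h'.le, if_neg hs1.not_ge, if_pos hs.le]
    exact hy s hs'
  · obtain ⟨y, hy⟩ := hsb
    refine ⟨y, ?_⟩
    filter_upwards [(hshift t).eventually (lt_mem_nhds h), eventually_abs_le_pi] with s hs hs'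
    rw [if_neg h.not_ge, if_pos le_rfl, if_neg hs.not_ge, hb]
    rcases le_or_gt s 0 with h0 | h0
    · rw [if_pos (by linarith)]
      exact (hy s hs').1 h0
    · rw [if_neg (by linarith)]
      exact (hy s hs').2 h0.le
  · obtain ⟨y, hy⟩ := hτ.exists_supports t
    refine ⟨y, ?_⟩
    filter_upwards [(hshift t).eventually (lt_mem_nhds h'), eventually_abs_le_pi] with s hs hs'
    rw [if_neg h.not_ge, if_neg h'.not_ge, if_neg (by linarith), if_neg hs.not_ge]
    exact hy s hs'

/-- The positive arch of a sinusoid over `[x, x + π]`, extended by zero. -/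
def arch (x t : ℝ) : ℝ := if x ≤ t ∧ t ≤ x + π then sin (t - x) else 0

theorem isTrigConvex_arch (x : ℝ) : IsTrigConvex (arch x) := by
  have hpi := pi_pos
  refine isTrigConvex_of_eventuallyEq fun t => ?_
  have hzero : ∀ s, s ∉ Icc x (x + π) → arch x s = 0 := fun s hs => if_neg hs
  rcases le_or_gt t (x - π / 2) with h | h
  · refine ⟨_, isTrigConvex_zero, ?_⟩
    filter_upwards [gt_mem_nhds (show t < x by linarith)] with s hs
    exact hzero s fun h => by linarith [h.1]
  rcases le_or_gt (x + 3 * π / 2) t with h' | h'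
  · refine ⟨_, isTrigConvex_zero, ?_⟩
    filter_upwards [lt_mem_nhds (show x + π < t by linarith)] with s hs
    exact hzero s fun h => by linarith [h.2]
  refine ⟨_, isTrigConvex_zero.max (isTrigConvex_sinusoid 0 1 x), ?_⟩
  filter_upwards [Ioo_mem_nhds h h'] with s hs
  simp only [arch, sinusoid, zero_mul, zero_add, one_mul]
  split_ifs with hc
  · exact (max_eq_right (sin_nonneg_of_nonneg_of_le_pi (by linarith) (by linarith))).symm
  · refine (max_eq_left ?_).symm
    rcases not_and_or.1 hc with h1 | h1
    · exact sin_nonpos_of_nonpos_of_neg_pi_le (by linarith) (by linarith [hs.1])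
    · have : sin (s - x) = -sin (s - x - π) := by rw [sin_sub_pi, neg_neg]
      rw [this, neg_nonpos]
      exact sin_nonneg_of_nonneg_of_le_pi (by linarith) (by linarith [hs.2])

/-! ### Minorants of the obstacle -/

/-- `τ` is a `P`-periodic trigonometrically convex minorant of the obstacle `R - g`. -/
structure IsMinorant (P R : ℝ) (g τ : ℝ → ℝ) : Prop where
  periodic : Function.Periodic τ P
  convex : IsTrigConvex τ
  le : ∀ t, g t + τ t ≤ R

theorem IsMinorant.average {P R : ℝ} {g τ₁ τ₂ : ℝ → ℝ} (h₁ : IsMinorant P R g τ₁)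
    (h₂ : IsMinorant P R g τ₂) : IsMinorant P R g fun t => 1 / 2 * τ₁ t + 1 / 2 * τ₂ t where
  periodic t := by simp only [h₁.periodic t, h₂.periodic t]
  convex := (h₁.convex.const_mul (by norm_num)).add (h₂.convex.const_mul (by norm_num))
  le t := by have := h₁.le t; have := h₂.le t; linarith

/-- By compactness, there is a lowest level `R` whose obstacle `R - g` has a minorant. -/
theorem exists_least_level {P : ℝ} {g : ℝ → ℝ} (hg : IsTrigConvex g) {M : ℝ}
    (hM : ∀ t, |g t| ≤ M) :
    ∃ R, (∃ τ, IsMinorant P R g τ) ∧ ∀ R' τ, IsMinorant P R' g τ → R ≤ R' := by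
  have hM0 : 0 ≤ M := (abs_nonneg _).trans (hM 0)
  have hpos : ∀ {R τ}, IsMinorant P R g τ → 0 ≤ R := fun {R τ} h => by
    have := h.le 0; have := h.le (0 + π); have := hg.antipodal 0; have := h.convex.antipodal 0
    linarith
  obtain ⟨K, hK⟩ : ∃ K : Set ((ℝ → ℝ) × ℝ), K = {p | IsMinorant P p.2 g p.1} ∩
      (univ.pi fun _ => Icc (-(2 * M)) (2 * M)) ×ˢ Icc 0 M := ⟨_, rfl⟩
  have ev : ∀ t : ℝ, Continuous fun p : (ℝ → ℝ) × ℝ => p.1 t := fun t =>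
    (continuous_apply t).comp continuous_fst
  have hcl : IsClosed {p : (ℝ → ℝ) × ℝ | IsMinorant P p.2 g p.1} := by
    have e : {p : (ℝ → ℝ) × ℝ | IsMinorant P p.2 g p.1} =
        (⋂ t, {p | p.1 (t + P) = p.1 t}) ∩
        (⋂ t, ⋂ a, ⋂ b, ⋂ (_ : 0 < a), ⋂ (_ : 0 < b), ⋂ (_ : a + b < π),
          {p | p.1 t * sin (a + b) ≤ p.1 (t - a) * sin b + p.1 (t + b) * sin a}) ∩
        ⋂ t, {p | g t + p.1 t ≤ p.2} := by
      ext p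
      simp only [mem_inter_iff, mem_iInter]
      exact ⟨fun h => ⟨⟨h.1, h.2⟩, h.3⟩, fun h => ⟨h.1.1, h.1.2, h.2⟩⟩
    rw [e]
    refine ((isClosed_iInter fun t => isClosed_eq (ev _) (ev _)).inter ?_).inter
      (isClosed_iInter fun t => isClosed_le (continuous_const.add (ev t)) continuous_snd)
    exact isClosed_iInter fun t => isClosed_iInter fun a => isClosed_iInter fun b =>
      isClosed_iInter fun _ => isClosed_iInter fun _ => isClosed_iInter fun _ =>
      isClosed_le ((ev _).mul continuous_const)
        (((ev _).mul continuous_const).add ((ev _).mul continuous_const))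
  have hcomp : IsCompact K := by
    rw [hK]
    exact ((isCompact_univ_pi fun _ => isCompact_Icc).prod isCompact_Icc).inter_left hcl
  have h0 : IsMinorant P M g fun _ => 0 :=
    ⟨fun _ => rfl, isTrigConvex_zero, fun t => by linarith [le_abs_self (g t), hM t]⟩
  have hne : K.Nonempty := ⟨(fun _ => 0, M), by
    rw [hK]
    exact ⟨h0, fun t _ => ⟨by simp [hM0], by simp [hM0]⟩, hM0, le_rfl⟩⟩
  obtain ⟨⟨τ, R⟩, hp, hmin⟩ := hcomp.exists_isMinOn hne continuous_snd.continuousOn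
  rw [hK] at hp
  refine ⟨R, ⟨τ, hp.1⟩, fun R' τ' h' => ?_⟩
  rcases le_total R' M with hR | hR
  · refine hmin (a := (τ', R')) ?_
    rw [hK]
    have up : ∀ t, τ' t ≤ 2 * M := fun t => by
      have := h'.le t; have := neg_le_of_abs_le (hM t); linarith
    refine ⟨h', fun t _ => ⟨?_, up t⟩, hpos h', hR⟩
    have := h'.convex.antipodal t
    have := up (t + π)
    dsimp only
    linarith
  · exact hp.2.2.2.trans hR

/-- At the lowest level, some point is a contact point of all minorants: otherwise an average of
finitely many minorants would have no contact, and the level could be lowered. -/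
theorem exists_forced_contact {P R : ℝ} {g : ℝ → ℝ} (hP : 0 < P) (hg : Continuous g)
    (hper : Function.Periodic g P) (hex : ∃ τ, IsMinorant P R g τ)
    (hmin : ∀ R' τ, IsMinorant P R' g τ → R ≤ R') :
    ∃ t, ∀ τ, IsMinorant P R g τ → g t + τ t = R := by
  by_contra! hcon
  have key : ∃ τ, IsMinorant P R g τ ∧ ∀ t ∈ Icc 0 P, g t + τ t < R := by
    refine isCompact_Icc.induction_on
      (p := fun S => ∃ τ, IsMinorant P R g τ ∧ ∀ t ∈ S, g t + τ t < R) ?_ ?_ ?_ ?_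
    · obtain ⟨τ, hτ⟩ := hex
      exact ⟨τ, hτ, by simp⟩
    · rintro S T hST ⟨τ, hτ, h⟩
      exact ⟨τ, hτ, fun t ht => h t (hST ht)⟩
    · rintro S T ⟨τ₁, h₁, hS⟩ ⟨τ₂, h₂, hT⟩
      refine ⟨_, h₁.average h₂, fun t ht => ?_⟩
      have := h₁.le t
      have := h₂.le t
      rcases ht with ht | ht
      · have := hS t ht
        linarith
      · have := hT t ht
        linarith
    · intro t _
      obtain ⟨τ, hτ, hne⟩ := hcon t
      have hlt := lt_of_le_of_ne (hτ.le t) hne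
      have hc := hτ.convex.continuous
      have hc' : ContinuousAt (fun x => g x + τ x) t := by fun_prop
      exact ⟨_, mem_nhdsWithin_of_mem_nhds (hc'.eventually (gt_mem_nhds hlt)), τ, hτ,
        fun x hx => hx⟩
  obtain ⟨τ, hτ, hlt⟩ := key
  have hc := hτ.convex.continuous
  obtain ⟨m, hm, hmax⟩ := isCompact_Icc.exists_isMaxOn (⟨0, le_rfl, hP.le⟩ : (Icc 0 P).Nonempty)
    (f := fun x => g x + τ x) (by fun_prop)
  have := hmin (g m + τ m) τ ⟨hτ.periodic, hτ.convex, fun t => by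
    obtain ⟨y, hy, e⟩ := (hper.add hτ.periodic).exists_mem_Ico₀ hP t
    simp only [Pi.add_apply] at e
    rw [e]
    exact hmax (Ico_subset_Icc_self hy)⟩
  exact (hlt m hm).not_ge this

/-- The greatest periodic trigonometrically convex minorant of the obstacle `R - g`. -/
structure IsGreatestMinorant (P R : ℝ) (g τ : ℝ → ℝ) : Prop extends IsMinorant P R g τ where
  greatest : ∀ τ', IsMinorant P R g τ' → ∀ t, τ' t ≤ τ t

theorem exists_isGreatestMinorant {P R : ℝ} {g : ℝ → ℝ} (hex : ∃ τ, IsMinorant P R g τ) :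
    ∃ τ, IsGreatestMinorant P R g τ := by
  obtain ⟨σ, hσ⟩ := hex
  have hbdd : ∀ t, BddAbove {x | ∃ τ, IsMinorant P R g τ ∧ τ t = x} := fun t =>
    ⟨R - g t, by rintro _ ⟨τ, hτ, rfl⟩; linarith [hτ.le t]⟩
  have hne : ∀ t, {x | ∃ τ, IsMinorant P R g τ ∧ τ t = x}.Nonempty := fun t => ⟨_, σ, hσ, rfl⟩
  have hle : ∀ τ, IsMinorant P R g τ → ∀ t, τ t ≤ sSup {x | ∃ τ, IsMinorant P R g τ ∧ τ t = x} :=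
    fun τ hτ t => le_csSup (hbdd t) ⟨τ, hτ, rfl⟩
  refine ⟨fun t => sSup {x | ∃ τ, IsMinorant P R g τ ∧ τ t = x}, ⟨fun t => ?_, ?_, fun t => ?_⟩,
    hle⟩
  · congr 1
    ext x
    exact exists_congr fun τ => and_congr_right fun hτ => by rw [hτ.periodic t]
  · intro t a b ha hb hab
    have sab : 0 < sin (a + b) := sin_pos_of_pos_of_lt_pi (by linarith) hab
    have sa : 0 < sin a := sin_pos_of_pos_of_lt_pi ha (by linarith)
    have sb : 0 < sin b := sin_pos_of_pos_of_lt_pi hb (by linarith)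
    rw [← le_div_iff₀ sab]
    refine csSup_le (hne t) ?_
    rintro _ ⟨τ, hτ, rfl⟩
    rw [le_div_iff₀ sab]
    refine (hτ.convex t a b ha hb hab).trans ?_
    have := hle τ hτ (t - a)
    have := hle τ hτ (t + b)
    gcongr
  · have : sSup {x | ∃ τ, IsMinorant P R g τ ∧ τ t = x} ≤ R - g t :=
      csSup_le (hne t) (by rintro _ ⟨τ, hτ, rfl⟩; linarith [hτ.le t])
    linarith

/-- The greatest minorant inherits every period of the obstacle. -/
theorem IsGreatestMinorant.periodic_of {P R Q : ℝ} {g τ : ℝ → ℝ} (h : IsGreatestMinorant P R g τ)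
    (hg : Function.Periodic g Q) : Function.Periodic τ Q := by
  have hshift : ∀ c, Function.Periodic g c → ∀ t, τ (t + c) ≤ τ t := by
    intro c hc
    refine h.greatest (fun t => τ (t + c)) ⟨fun t => ?_, h.convex.add_arg c, fun t => ?_⟩
    · have : t + P + c = t + c + P := by ring
      simp only [this, h.periodic (t + c)]
    · have := h.le (t + c)
      rwa [hc t] at this
  intro t
  refine (hshift Q hg t).antisymm ?_
  have := hshift (-Q) hg.neg (t + Q)
  rwa [add_neg_cancel_right] at this

/-- Where the greatest minorant does not touch the obstacle, it cannot be raised. -/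
theorem IsGreatestMinorant.not_raised {P R a b : ℝ} {g τ f₀ : ℝ → ℝ}
    (h : IsGreatestMinorant P R g τ) (hg : Continuous g) (hper : Function.Periodic g P)
    (hP : 0 < P) (hle : a ≤ b) (hab : b - a < P)
    (hf₀ : IsTrigConvex f₀) (hout : ∀ t, t ∉ Icc a b → f₀ t = τ t)
    (hno : ∀ t ∈ Icc a b, g t + τ t ≠ R) : ∀ t ∈ Icc a b, f₀ t ≤ τ t := by
  have hc := h.convex.continuous
  have hc₀ := hf₀.continuous
  have hne : (Icc a b).Nonempty := ⟨a, le_rfl, hle⟩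
  obtain ⟨m, hm, hmax⟩ := isCompact_Icc.exists_isMaxOn hne (f := fun x => g x + τ x) (by fun_prop)
  obtain ⟨n, hn, hmax'⟩ := isCompact_Icc.exists_isMaxOn hne (f := fun x => f₀ x - τ x)
    (by fun_prop)
  have hδ : 0 < R - (g m + τ m) := sub_pos.2 (lt_of_le_of_ne (h.le m) (hno m hm))
  rcases le_or_gt (f₀ n - τ n) 0 with hn0 | hn0
  · intro t ht
    have : f₀ t - τ t ≤ f₀ n - τ n := hmax' ht
    linarith
  -- A step `ε` towards `f₀` uses up at most the gap below the obstacle on `[a, b]`.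
  obtain ⟨ε, hε⟩ : ∃ ε, ε = min 1 ((R - (g m + τ m)) / (f₀ n - τ n)) := ⟨_, rfl⟩
  have hε0 : 0 < ε := by rw [hε]; exact lt_min one_pos (div_pos hδ hn0)
  have hε1 : ε ≤ 1 := by rw [hε]; exact min_le_left _ _
  have hε2 : ε * (f₀ n - τ n) ≤ R - (g m + τ m) := by
    rw [← le_div_iff₀ hn0, hε]; exact min_le_right _ _
  have hf₁ : IsTrigConvex fun t => (1 - ε) * τ t + ε * f₀ t :=
    (h.convex.const_mul (by linarith)).add (hf₀.const_mul hε0.le)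
  have hle₁ : ∀ t, g t + ((1 - ε) * τ t + ε * f₀ t) ≤ R := by
    intro t
    by_cases ht : t ∈ Icc a b
    · have h1 : g t + τ t ≤ g m + τ m := hmax ht
      have h2 : f₀ t - τ t ≤ f₀ n - τ n := hmax' ht
      have := mul_le_mul_of_nonneg_left h2 hε0.le
      linarith
    · rw [hout t ht]
      linarith [h.le t]
  obtain ⟨f, hf, hfper, hfin, hfval⟩ := h.convex.periodize h.periodic hf₁ hP hab hle
    fun t ht => by rw [hout t ht]; ring
  have hf' : IsMinorant P R g f := ⟨hfper, hf, fun t => by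
    obtain ⟨k, hk⟩ := hfval t
    rw [hk, ← hper.sub_int_mul_eq k]
    exact hle₁ _⟩
  intro t ht
  have h1 := h.greatest f hf' t
  rw [hfin t ht] at h1
  have : ε * (f₀ t - τ t) ≤ ε * 0 := by linarith
  have := le_of_mul_le_mul_left this hε0
  linarith

/-- Otherwise the greatest minorant could be raised by an arch over `[x, x + π]`. -/
theorem IsGreatestMinorant.exists_contact {P R : ℝ} {g τ : ℝ → ℝ}
    (h : IsGreatestMinorant P R g τ) (hg : Continuous g) (hper : Function.Periodic g P)
    (hP : π < P) (x : ℝ) : ∃ t ∈ Icc x (x + π), g t + τ t = R := by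
  by_contra! hcon
  have hpi := pi_pos
  have := h.not_raised hg hper (by linarith) (by linarith : x ≤ x + π) (by linarith)
    (h.convex.add (isTrigConvex_arch x))
    (fun t ht => by have : arch x t = 0 := if_neg ht
                    rw [this, add_zero]) hcon (x + π / 2) ⟨by linarith, by linarith⟩
  have e : arch x (x + π / 2) = 1 := by
    rw [arch, if_pos ⟨by linarith, by linarith⟩]
    simp
  rw [e] at this
  linarith

/-- On a short interval without contact, the greatest minorant is a sinusoid. -/
theorem IsGreatestMinorant.eq_chord {P R a b : ℝ} {g τ : ℝ → ℝ}
    (h : IsGreatestMinorant P R g τ) (hg : Continuous g) (hper : Function.Periodic g P)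
    (hP : π < P) (hlt : a < b) (hab : b - a < π) (hno : ∀ t ∈ Icc a b, g t + τ t ≠ R) :
    ∃ A B c, ∀ t ∈ Icc a b, τ t = sinusoid A B c t := by
  have hS : 0 < sin (b - a) := sin_pos_of_pos_of_lt_pi (by linarith) hab
  have hτ := h.convex
  obtain ⟨B, hB⟩ : ∃ B, B = (τ b - τ a * cos (b - a)) / sin (b - a) := ⟨_, rfl⟩
  have hbv : sinusoid (τ a) B a b = τ b := by
    rw [sinusoid, hB]; field_simp; ring
  have hav : sinusoid (τ a) B a a = τ a := sinusoid_self _ _ _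
  have hin := hτ.le_sinusoid hlt hab hav hbv
  -- Beyond the interval the chord lies below `τ`, so it supports the modification at both ends.
  have hleft := hτ.sinusoid_le_left hlt hab hav hbv
  have hright := hτ.sinusoid_le_right hlt hab hav hbv
  have hf₀ := hτ.replace (isTrigConvex_sinusoid (τ a) B a) hlt hav hbv
    ⟨_, fun s hs => ⟨fun h0 => by
      have := hleft s hs h0
      rwa [sinusoid_add, hav] at this, fun _ => by rw [sinusoid_add, hav]⟩⟩
    ⟨_, fun s hs => ⟨fun _ => by rw [sinusoid_add, hbv], fun h0 => by
      have := hright s hs h0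
      rwa [sinusoid_add, hbv] at this⟩⟩
  have hfin := h.not_raised hg hper (by linarith [pi_pos]) hlt.le (by linarith) hf₀ (fun t ht => by
    split_ifs with h1 h2
    · rfl
    · exact absurd ⟨(not_le.1 h1).le, h2⟩ ht
    · rfl) hno
  refine ⟨_, B, _, fun t ht => (hin t ht).antisymm ?_⟩
  rcases ht.1.eq_or_lt with rfl | h1
  · exact hav.le
  have := hfin t ht
  simpa only [if_neg h1.not_ge, if_pos ht.2] using this

/-! ### Sinusoidal intervals of the greatest minorant -/

/-- The left-hand side is maximal at `s = 0`, so its derivative vanishes there. -/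
theorem eq_zero_of_cos_add_sin_le {R Y : ℝ} (h : ∀ s, |s| ≤ π → R * cos s + Y * sin s ≤ R) :
    Y = 0 := by
  have hmax : IsLocalMax (fun s => R * cos s + Y * sin s) 0 := by
    filter_upwards [eventually_abs_le_pi] with s hs
    simpa using h s hs
  have hd : HasDerivAt (fun s => R * cos s + Y * sin s) (R * -sin 0 + Y * cos 0) 0 :=
    ((hasDerivAt_cos 0).const_mul R).add ((hasDerivAt_sin 0).const_mul Y)
  simpa using hmax.hasDerivAt_eq_zero hd

/-- At a contact point the slope of the supporting sinusoid is unique, since the obstacle is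
trigonometrically concave up to a constant. -/
theorem IsMinorant.supports_unique {P R t y₁ y₂ : ℝ} {g τ : ℝ → ℝ} (h : IsMinorant P R g τ)
    (hg : IsTrigConvex g) (ht : g t + τ t = R) (h₁ : Supports τ t y₁) (h₂ : Supports τ t y₂) :
    y₁ = y₂ := by
  obtain ⟨y, hy⟩ := hg.exists_supports t
  have key : ∀ z, Supports τ t z → y + z = 0 := fun z hz =>
    eq_zero_of_cos_add_sin_le (R := R) fun s hs => by
      have := hy s hs
      have := hz s hs
      have := h.le (t + s)
      rw [← ht] at this ⊢
      linarith
  linarith [key _ h₁, key _ h₂]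

/-- A run to the right, starting at `t`, of a function that is locally a sinusoid off a closed set
`{u = R}` ends in that set, unless it is longer than `2π`. -/
theorem exists_run_right {τ u : ℝ → ℝ} {R t A B c : ℝ} (hτ : Continuous τ) (hu : Continuous u)
    (hchord : ∀ a b, a < b → b - a < π → (∀ x ∈ Icc a b, u x ≠ R) →
      ∃ A B c, ∀ x ∈ Icc a b, τ x = sinusoid A B c x)
    (ht : u t = R) (hσ : τ t = sinusoid A B c t) :
    ∃ d ≥ t, (∀ x ∈ Icc t d, τ x = sinusoid A B c x) ∧ (d = t + 2 * π ∨
      (u d = R ∧ ∀ d' > d, ∃ x ∈ Icc t d', τ x ≠ sinusoid A B c x)) := by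
  have hpi := pi_pos
  have hcσ := continuous_sinusoid A B c
  obtain ⟨D, hD⟩ : ∃ D : Set ℝ, D = {d | d ∈ Icc t (t + 2 * π) ∧
      ∀ x ∈ Icc t d, τ x = sinusoid A B c x} := ⟨_, rfl⟩
  have htD : t ∈ D := by
    rw [hD]
    refine ⟨⟨le_rfl, by linarith⟩, fun x hx => ?_⟩
    rw [le_antisymm hx.2 hx.1, hσ]
  have hDb : BddAbove D := ⟨t + 2 * π, fun d hd => by rw [hD] at hd; exact hd.1.2⟩
  have htd : t ≤ sSup D := le_csSup hDb htD
  have hd2 : sSup D ≤ t + 2 * π := csSup_le ⟨t, htD⟩ fun d hd => by rw [hD] at hd; exact hd.1.2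
  have heq : ∀ x ∈ Icc t (sSup D), τ x = sinusoid A B c x := by
    rcases htd.eq_or_lt with h | h
    · intro x hx
      rw [← h] at hx
      rw [le_antisymm hx.2 hx.1, hσ]
    · have hIoo : ∀ x ∈ Ioo t (sSup D), τ x = sinusoid A B c x := fun x hx => by
        obtain ⟨d, hd, hxd⟩ := exists_lt_of_lt_csSup ⟨t, htD⟩ hx.2
        rw [hD] at hd
        exact hd.2 x ⟨hx.1.le, hxd.le⟩
      exact fun x hx => le_antisymm (le_of_le_Ioo hτ hcσ h (fun x hx => (hIoo x hx).le) x hx)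
        (le_of_le_Ioo hcσ hτ h (fun x hx => (hIoo x hx).ge) x hx)
  have hmaxl : sSup D < t + 2 * π → ∀ d' > sSup D, ∃ x ∈ Icc t d', τ x ≠ sinusoid A B c x := by
    intro hlt d' hd'
    by_contra! hcon
    have : min d' (t + 2 * π) ∈ D := by
      rw [hD]
      exact ⟨⟨le_min (htd.trans hd'.le) (by linarith), min_le_right _ _⟩,
        fun x hx => hcon x ⟨hx.1, hx.2.trans (min_le_left _ _)⟩⟩
    exact ((le_csSup hDb this).trans_lt (lt_min hd' hlt)).false
  refine ⟨sSup D, htd, heq, ?_⟩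
  rcases hd2.eq_or_lt with h | h
  · exact Or.inl h
  refine Or.inr ⟨?_, hmaxl h⟩
  -- Off `{u = R}` the function is one sinusoid on both sides of the end point, so the run goes on.
  by_contra hne
  have htd' : t < sSup D := lt_of_le_of_ne htd fun e => hne (e ▸ ht)
  obtain ⟨ε, hε, hball⟩ := Metric.eventually_nhds_iff.1
    (hu.continuousAt.eventually_ne hne : ∀ᶠ x in 𝓝 (sSup D), u x ≠ R)
  obtain ⟨η, hη0, hη⟩ := exists_between (lt_min (lt_min hε (sub_pos.2 htd')) one_pos)
  rw [lt_min_iff, lt_min_iff] at hη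
  obtain ⟨A', B', c', hc'⟩ := hchord (sSup D - η) (sSup D + η) (by linarith)
    (by linarith [pi_gt_three]) fun x hx => hball (by
      rw [Real.dist_eq]
      exact (abs_le.2 ⟨by linarith [hx.1], by linarith [hx.2]⟩ : |x - sSup D| ≤ η).trans_lt hη.1.1)
  have hagree : ∀ x ∈ Icc (sSup D - η) (sSup D), sinusoid A' B' c' x = sinusoid A B c x :=
    fun x hx => by
      rw [← hc' x ⟨hx.1, by linarith [hx.2]⟩, heq x ⟨by linarith [hx.1, hη.1.2], hx.2⟩]
  have hext := sinusoid_ext (by linarith : sSup D - η < sSup D) (by linarith [pi_gt_three])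
    (hagree _ ⟨le_rfl, by linarith⟩) (hagree _ ⟨by linarith, le_rfl⟩)
  obtain ⟨x, hx, hxne⟩ := hmaxl h (sSup D + η) (by linarith)
  rcases le_total x (sSup D) with h1 | h1
  · exact hxne (heq x ⟨hx.1, h1⟩)
  · exact hxne ((hc' x ⟨by linarith, hx.2⟩).trans (hext x))

theorem sinusoid_neg (A B c x : ℝ) : sinusoid A B c (-x) = sinusoid A (-B) (-c) x := by
  have e : -x - c = -(x - -c) := by ring
  simp only [sinusoid, e, cos_neg, sin_neg]
  ring

/-- The mirror image of `exists_run_right`. -/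
theorem exists_run_left {τ u : ℝ → ℝ} {R t A B c : ℝ} (hτ : Continuous τ) (hu : Continuous u)
    (hchord : ∀ a b, a < b → b - a < π → (∀ x ∈ Icc a b, u x ≠ R) →
      ∃ A B c, ∀ x ∈ Icc a b, τ x = sinusoid A B c x)
    (ht : u t = R) (hσ : τ t = sinusoid A B c t) :
    ∃ d ≤ t, (∀ x ∈ Icc d t, τ x = sinusoid A B c x) ∧ (d = t - 2 * π ∨
      (u d = R ∧ ∀ d' < d, ∃ x ∈ Icc d' t, τ x ≠ sinusoid A B c x)) := by
  have hflip : ∀ {a b x : ℝ}, x ∈ Icc (-b) (-a) → -x ∈ Icc a b := fun {a b x} hx =>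
    ⟨by linarith [hx.2], by linarith [hx.1]⟩
  obtain ⟨d, hd, heq, hend⟩ := exists_run_right (τ := fun x => τ (-x)) (u := fun x => u (-x))
    (R := R) (t := -t) (A := A) (B := -B) (c := -c) (by fun_prop) (by fun_prop) (by
      intro a b hab hπ hno
      obtain ⟨A, B, c, h⟩ := hchord (-b) (-a) (by linarith) (by linarith) fun x hx => by
        have := hno (-x) (hflip hx)
        rwa [neg_neg] at this
      refine ⟨A, -B, -c, fun x hx => ?_⟩
      rw [h (-x) (hflip (by simpa using hx)), sinusoid_neg])
    (by simpa using ht) (by rw [← sinusoid_neg]; simpa using hσ)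
  refine ⟨-d, by linarith, fun x hx => ?_, ?_⟩
  · have := heq (-x) (hflip (by simpa using hx))
    rw [← sinusoid_neg] at this
    simpa using this
  rcases hend with rfl | ⟨h1, h2⟩
  · left; ring
  · refine Or.inr ⟨h1, fun d' hd' => ?_⟩
    obtain ⟨x, hx, hne⟩ := h2 (-d') (by linarith)
    rw [← sinusoid_neg] at hne
    exact ⟨-x, hflip (by simpa using hx), hne⟩

/-- If two supporting sinusoids at nearby points on both sides of a forced contact point both missed
that point, the minorant could be cut down to their maximum between the two points. Hence it is a
sinusoid on one side. -/
theorem IsMinorant.sinusoid_near_forced {P R t y a b : ℝ} {g τ : ℝ → ℝ} (h : IsMinorant P R g τ)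
    (hg : IsTrigConvex g) (hper : Function.Periodic g P) (hP : π < P)
    (hforced : ∀ τ', IsMinorant P R g τ' → g t + τ' t = R) (hy : Supports τ t y)
    (ha : a < t) (hb : t < b) (hab : b - a < π) :
    (∀ x ∈ Icc a t, τ x = sinusoid (τ t) y t x) ∨ ∀ x ∈ Icc t b, τ x = sinusoid (τ t) y t x := by
  have hτ := h.convex
  have ht := hforced τ h
  obtain ⟨y₁, hy₁⟩ := hτ.exists_supports a
  obtain ⟨y₂, hy₂⟩ := hτ.exists_supports b
  have hle₁ : ∀ x, |x - a| ≤ π → sinusoid (τ a) y₁ a x ≤ τ x := fun x hx => hy₁.sinusoid_le hx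
  have hle₂ : ∀ x, |x - b| ≤ π → sinusoid (τ b) y₂ b x ≤ τ x := fun x hx => hy₂.sinusoid_le hx
  obtain ⟨φ, hφ⟩ : ∃ φ : ℝ → ℝ, φ = fun x =>
    max (sinusoid (τ a) y₁ a x) (sinusoid (τ b) y₂ b x) := ⟨_, rfl⟩
  have hφc : IsTrigConvex φ := by
    rw [hφ]; exact (isTrigConvex_sinusoid _ _ _).max (isTrigConvex_sinusoid _ _ _)
  have hφle : ∀ x ∈ Icc a b, φ x ≤ τ x := fun x hx => by
    rw [hφ]
    exact max_le (hle₁ x (abs_le.2 ⟨by linarith [hx.1], by linarith [hx.2]⟩))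
      (hle₂ x (abs_le.2 ⟨by linarith [hx.1], by linarith [hx.2]⟩))
  have hφa : φ a = τ a := le_antisymm (hφle a ⟨le_rfl, by linarith⟩) (by
    rw [hφ]; exact (sinusoid_self _ _ _).ge.trans (le_max_left _ _))
  have hφb : φ b = τ b := le_antisymm (hφle b ⟨by linarith, le_rfl⟩) (by
    rw [hφ]; exact (sinusoid_self _ _ _).ge.trans (le_max_right _ _))
  have hf₀ := hτ.replace hφc (ha.trans hb) hφa hφb
    ⟨y₁, fun s hs => ⟨fun _ => hy₁ s hs, fun _ => by
      rw [hφ]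
      refine le_trans (le_of_eq ?_) (le_max_left _ _)
      simp [sinusoid]⟩⟩
    ⟨y₂, fun s hs => ⟨fun _ => by
      rw [hφ]
      refine le_trans (le_of_eq ?_) (le_max_right _ _)
      simp [sinusoid], fun _ => hy₂ s hs⟩⟩
  obtain ⟨f, hf, hfper, hfin, hfval⟩ := hτ.periodize h.periodic hf₀ (by linarith [pi_pos])
    (by linarith) (ha.trans hb).le fun x hx => by
      split_ifs with h1 h2
      · rfl
      · exact absurd ⟨(not_le.1 h1).le, h2⟩ hx
      · rfl
  have hfm : IsMinorant P R g f := ⟨hfper, hf, fun x => by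
    obtain ⟨k, hk⟩ := hfval x
    have hle := h.le (x - k * P)
    rw [hk, ← hper.sub_int_mul_eq k]
    split_ifs with h1 h2
    · exact hle
    · linarith [hφle (x - k * P) ⟨(not_le.1 h1).le, h2⟩]
    · exact hle⟩
  have hφt : φ t = τ t := by
    have h1 := hforced f hfm
    rw [hfin t ⟨ha.le, hb.le⟩, if_neg ha.not_ge, if_pos hb.le] at h1
    linarith
  -- A supporting sinusoid that passes through the contact point is the supporting sinusoid there.
  have hσ : ∀ A B c, sinusoid A B c t = τ t →
      (∀ s, |s| ≤ π → sinusoid A B c (t + s) ≤ τ (t + s)) →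
      ∀ x, sinusoid A B c x = sinusoid (τ t) y t x := by
    intro A B c hA hsup x
    have := h.supports_unique hg ht (y₁ := B * cos (t - c) - A * sin (t - c)) (fun s hs => by
      have := hsup s hs
      rwa [sinusoid_add, hA] at this) hy
    have e := sinusoid_add A B c t (x - t)
    rw [add_sub_cancel, hA, this] at e
    exact e
  rw [hφ] at hφt
  rcases max_choice (sinusoid (τ a) y₁ a t) (sinusoid (τ b) y₂ b t) with hm | hm
  · left
    have hA : sinusoid (τ a) y₁ a t = τ t := hm ▸ hφt
    have hall := hσ _ _ _ hA fun s hs => by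
      rcases le_total s 0 with h0 | h0
      · exact hle₁ _ (abs_le.2 ⟨by linarith [(abs_le.1 hs).1], by linarith⟩)
      · exact hτ.sinusoid_le_right ha (by linarith) (sinusoid_self _ _ _) hA s hs h0
    intro x hx
    rw [← hall]
    exact le_antisymm (hτ.le_sinusoid ha (by linarith) (sinusoid_self _ _ _) hA x hx)
      (hle₁ x (abs_le.2 ⟨by linarith [hx.1], by linarith [hx.2]⟩))
  · right
    have hA : sinusoid (τ b) y₂ b t = τ t := hm ▸ hφt
    have hall := hσ _ _ _ hA fun s hs => by
      rcases le_total s 0 with h0 | h0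
      · exact hτ.sinusoid_le_left hb (by linarith) hA (sinusoid_self _ _ _) s hs h0
      · exact hle₂ _ (abs_le.2 ⟨by linarith, by linarith [(abs_le.1 hs).2]⟩)
    intro x hx
    rw [← hall]
    exact le_antisymm (hτ.le_sinusoid hb (by linarith) hA (sinusoid_self _ _ _) x hx)
      (hle₂ x (abs_le.2 ⟨by linarith [hx.1], by linarith [hx.2]⟩))

/-- At the lowest level the greatest minorant is a sinusoid on an interval of length at least `π`
and less than `2π` whose end points are contact points. -/
theorem IsGreatestMinorant.exists_sinusoidal_interval {P R t₀ : ℝ} {g τ : ℝ → ℝ}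
    (h : IsGreatestMinorant P R g τ) (hg : IsTrigConvex g) (hper : Function.Periodic g P)
    (hP : π < P) (hforced : ∀ τ', IsMinorant P R g τ' → g t₀ + τ' t₀ = R) :
    ∃ s e A B c, s + π ≤ e ∧ e < s + 2 * π ∧ g s + τ s = R ∧ g e + τ e = R ∧
      ∀ x ∈ Icc s e, τ x = sinusoid A B c x := by
  have hpi := pi_pos
  have hτ := h.convex
  have hcτ := hτ.continuous
  have hcg := hg.continuous
  have ht := hforced τ h.toIsMinorant
  obtain ⟨y, hy⟩ := hτ.exists_supports t₀
  have hcu : Continuous fun x => g x + τ x := by fun_prop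
  have hchord := fun a b hlt hab hno => h.eq_chord (a := a) (b := b) hcg hper hP hlt hab hno
  have key : ∃ s e, s + π ≤ e ∧ g s + τ s = R ∧ g e + τ e = R ∧
      ∀ x ∈ Icc s e, τ x = sinusoid (τ t₀) y t₀ x := by
    obtain ⟨d, hd, hdeq, hdend⟩ := exists_run_right (u := fun x => g x + τ x) (R := R) hcτ hcu
      hchord ht (sinusoid_self (τ t₀) y t₀).symm
    obtain ⟨c, hc, hceq, hcend⟩ := exists_run_left (u := fun x => g x + τ x) (R := R) hcτ hcu
      hchord ht (sinusoid_self (τ t₀) y t₀).symm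
    rcases hdend with rfl | ⟨hdR, hdmax⟩
    · obtain ⟨e, he, heR⟩ := h.exists_contact hcg hper hP (t₀ + π)
      exact ⟨t₀, e, he.1, ht, heR, fun x hx => hdeq x ⟨hx.1, by linarith [hx.2, he.2]⟩⟩
    rcases hcend with rfl | ⟨hcR, hcmax⟩
    · obtain ⟨s, hs, hsR⟩ := h.exists_contact hcg hper hP (t₀ - 2 * π)
      exact ⟨s, t₀, by linarith [hs.2], hsR, ht,
        fun x hx => hceq x ⟨by linarith [hx.1, hs.1], hx.2⟩⟩
    refine ⟨c, d, ?_, hcR, hdR, fun x hx => ?_⟩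
    · by_contra! hlt
      obtain ⟨η, hη0, hη⟩ := exists_between (show 0 < (c + π - d) / 2 by linarith)
      obtain ⟨x, hx, hxne⟩ := hdmax (d + η) (by linarith)
      obtain ⟨x', hx', hxne'⟩ := hcmax (c - η) (by linarith)
      rcases h.toIsMinorant.sinusoid_near_forced hg hper hP hforced hy
        (show c - η < t₀ by linarith) (show t₀ < d + η by linarith) (by linarith) with hh | hh
      · exact hxne' (hh x' hx')
      · exact hxne (hh x hx)
    · rcases le_total x t₀ with h1 | h1
      · exact hceq x ⟨hx.1, h1⟩
      · exact hdeq x ⟨h1, hx.2⟩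
  obtain ⟨s, e, hse, hs, he, heq⟩ := key
  rcases lt_or_ge e (s + 2 * π) with h2 | h2
  · exact ⟨s, e, _, _, _, hse, h2, hs, he, heq⟩
  suffices hv : ∃ v, s + π ≤ v ∧ v < s + 2 * π ∧ g v + τ v = R by
    obtain ⟨v, hv1, hv2, hvR⟩ := hv
    exact ⟨s, v, _, _, _, hv1, hv2, hs, hvR, fun x hx => heq x ⟨hx.1, by linarith [hx.2]⟩⟩
  -- The last contact in `[s, s + π]` is followed by another one at distance at most `π`.
  have hcomp : IsCompact (Icc s (s + π) ∩ {x | g x + τ x = R}) :=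
    isCompact_Icc.inter_right (isClosed_eq hcu continuous_const)
  obtain ⟨u, ⟨hu, huR⟩, humax⟩ := hcomp.exists_isGreatest ⟨s, ⟨le_rfl, by linarith⟩, hs⟩
  rcases hu.2.eq_or_lt with h3 | h3
  · exact ⟨u, h3.ge, by linarith, huR⟩
  obtain ⟨v, hv, hvR⟩ := h.exists_contact hcg hper hP ((u + (s + π)) / 2)
  refine ⟨v, ?_, by linarith [hv.2], hvR⟩
  by_contra! hlt
  have := humax ⟨⟨by linarith [hv.1, hu.1], hlt.le⟩, hvR⟩
  linarith [hv.1]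

/-! ### Nests and their circumradii -/

/-- The linear functional `x cos t + y sin t` of the point `z = x + i y`. -/
def proj (z : ℂ) (t : ℝ) : ℝ := z.re * cos t + z.im * sin t

theorem continuous_proj (z : ℂ) : Continuous (proj z) := by unfold proj; fun_prop

theorem proj_add (z : ℂ) (t s : ℝ) :
    proj z (t + s) = proj z t * cos s + (z.im * cos t - z.re * sin t) * sin s := by
  simp only [proj, cos_add, sin_add]
  ring

theorem proj_sub (z w : ℂ) (t : ℝ) : proj (z - w) t = proj z t - proj w t := by
  simp only [proj, Complex.sub_re, Complex.sub_im]
  ring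

theorem periodic_proj (z : ℂ) : Function.Periodic (proj z) (2 * π) := fun t => by simp [proj]

theorem proj_eq_norm_mul_cos (z : ℂ) (t : ℝ) : proj z t = ‖z‖ * cos (t - z.arg) := by
  rw [cos_sub, proj]
  linear_combination -cos t * Complex.norm_mul_cos_arg z - sin t * Complex.norm_mul_sin_arg z

theorem proj_le_norm (z : ℂ) (t : ℝ) : proj z t ≤ ‖z‖ := by
  rw [proj_eq_norm_mul_cos]
  exact mul_le_of_le_one_right (norm_nonneg _) (cos_le_one _)

theorem exists_proj_eq_norm (z : ℂ) (a : ℝ) : ∃ t ∈ Ico a (a + 2 * π), proj z t = ‖z‖ := by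
  obtain ⟨t, ht, e⟩ := (periodic_proj z).exists_mem_Ico (by positivity) z.arg a
  refine ⟨t, ht, ?_⟩
  rw [← e, proj_eq_norm_mul_cos]
  simp

/-- Sinusoids are the functions `proj z`. -/
theorem exists_proj_eq_sinusoid (A B c : ℝ) : ∃ z : ℂ, ∀ t, proj z t = sinusoid A B c t :=
  ⟨⟨A * cos c - B * sin c, A * sin c + B * cos c⟩, fun t => by
    simp only [proj, sinusoid, cos_sub, sin_sub]
    ring⟩

/-- A lower sinusoid on `[t - π/2, t + π/2]` is one on `[t - π, t + π]`. -/
theorem IsTrigConvex.supports_of_half {f : ℝ → ℝ} (hf : IsTrigConvex f) {t y : ℝ}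
    (h : ∀ s, |s| ≤ π / 2 → f t * cos s + y * sin s ≤ f (t + s)) : Supports f t y := by
  refine hf.supports_of_Ioo fun a ha => ?_
  have hs : 0 < sin (a / 2) :=
    sin_pos_of_pos_of_lt_pi (by linarith [ha.1]) (by linarith [ha.1, ha.2])
  have hc : 0 ≤ cos (a / 2) := cos_nonneg_of_mem_Icc ⟨by linarith [ha.1, ha.2], by linarith [ha.2]⟩
  have e : cos a = 2 * cos (a / 2) ^ 2 - 1 := by rw [← cos_two_mul]; congr 1; ring
  have e' : sin a = 2 * sin (a / 2) * cos (a / 2) := by rw [← sin_two_mul]; congr 1; ring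
  have ea : a / 2 + a / 2 = a := by ring
  have habs : |a / 2| ≤ π / 2 := abs_le.2 ⟨by linarith [ha.1, ha.2], by linarith [ha.2]⟩
  constructor
  · have h1 := mul_le_mul_of_nonneg_right (h (a / 2) habs) (mul_nonneg hs.le hc)
    have h2 := hf (t + a / 2) (a / 2) (a / 2) (by linarith [ha.1]) (by linarith [ha.1])
      (by linarith [ha.2])
    have e1 : t + a / 2 - a / 2 = t := by ring
    have e2 : t + a / 2 + a / 2 = t + a := by ring
    rw [e1, e2, ea, e'] at h2
    refine le_of_mul_le_mul_right ?_ hs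
    rw [e, e']
    linarith
  · have h1 := h (-(a / 2)) (by rwa [abs_neg])
    rw [cos_neg, sin_neg] at h1
    have h1 := mul_le_mul_of_nonneg_right h1 (mul_nonneg hs.le hc)
    have h2 := hf (t + -(a / 2)) (a / 2) (a / 2) (by linarith [ha.1]) (by linarith [ha.1])
      (by linarith [ha.2])
    have e1 : t + -(a / 2) - a / 2 = t - a := by ring
    have e2 : t + -(a / 2) + a / 2 = t := by ring
    rw [e1, e2, ea, e'] at h2
    refine le_of_mul_le_mul_right ?_ hs
    rw [e, e']
    linarith

variable {ρ : ℝ} {h : ℝ → ℝ}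

theorem TC.isTrigConvex_stretch (hρ : 0 < ρ) (hh : TC ρ h) : IsTrigConvex (stretch ρ h) := by
  intro t a b ha hb hab
  have := hh.ineq ((t - a) / ρ) (t / ρ) ((t + b) / ρ) (by gcongr; linarith) (by gcongr; linarith)
    (by rw [← sub_div]; gcongr; linarith)
  have e1 : ρ * (t / ρ - (t + b) / ρ) = -b := by field_simp; ring
  have e2 : ρ * ((t + b) / ρ - (t - a) / ρ) = a + b := by field_simp; ring
  have e3 : ρ * ((t - a) / ρ - t / ρ) = -a := by field_simp; ring
  rw [e1, e2, e3, sin_neg, sin_neg] at this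
  simp only [stretch]
  linarith

theorem TC.periodic_stretch (hρ : 0 < ρ) (hh : TC ρ h) :
    Function.Periodic (stretch ρ h) (2 * π * ρ) := by
  intro t
  have : (t + 2 * π * ρ) / ρ = t / ρ + 2 * π := by field_simp
  simp only [stretch, this, hh.periodic (t / ρ)]

/-- The points of `K_t` correspond to the supporting sinusoids at `t`. -/
theorem supports_of_mem_piece (hg : IsTrigConvex (stretch ρ h)) {t : ℝ} {z : ℂ}
    (hz : z ∈ piece ρ h t) : ∃ y, Supports (stretch ρ h) t y ∧
      ∀ s, proj z (t + s) = stretch ρ h t * cos s + y * sin s := by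
  obtain ⟨h1, h2⟩ := hz
  simp only [mem_iInter] at h2
  have h1 : proj z t = stretch ρ h t := h1
  refine ⟨z.im * cos t - z.re * sin t, hg.supports_of_half fun s hs => ?_, fun s => ?_⟩
  · have : proj z (t + s) ≤ stretch ρ h (t + s) :=
      h2 (t + s) ⟨by linarith [(abs_le.1 hs).1], by linarith [(abs_le.1 hs).2]⟩
    rwa [proj_add, h1] at this
  · rw [proj_add, h1]

theorem exists_mem_piece (hg : IsTrigConvex (stretch ρ h)) (t : ℝ) :
    ∃ z ∈ piece ρ h t, proj z t = stretch ρ h t := by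
  obtain ⟨y, hy⟩ := hg.exists_supports t
  obtain ⟨z, hz⟩ := exists_proj_eq_sinusoid (stretch ρ h t) y t
  have ht : proj z t = stretch ρ h t := by rw [hz, sinusoid_self]
  refine ⟨z, ⟨ht, ?_⟩, ht⟩
  simp only [mem_iInter]
  intro s hs
  have := hy.sinusoid_le (x := s)
    (abs_le.2 ⟨by linarith [hs.1, pi_pos], by linarith [hs.2, pi_pos]⟩)
  rw [← hz] at this
  exact this

/-- The nest condition says that the restriction to `[α - 2π, α]`, repeated with period `2π`,
is trigonometrically convex at `α`. -/
theorem IsNest.three_point {α : ℝ} (hn : IsNest ρ h α) (hg : IsTrigConvex (stretch ρ h)) {a b : ℝ}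
    (ha : 0 < a) (hb : 0 < b) (hab : a + b < π) :
    stretch ρ h α * sin (a + b) ≤
      stretch ρ h (α - a) * sin b + stretch ρ h (α - 2 * π + b) * sin a := by
  obtain ⟨l, r, hl, hr, hlr⟩ := hn.deriv_le
  obtain ⟨l', _, hl', _, _, hsl⟩ := hg.exists_derivs α
  obtain ⟨_, r', _, hr', _, hsr⟩ := hg.exists_derivs (α - 2 * π)
  have el := (uniqueDiffWithinAt_Iic α).eq_deriv _ hl hl'
  have er := (uniqueDiffWithinAt_Ici (α - 2 * π)).eq_deriv _ hr hr'
  subst el er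
  have sa : 0 < sin a := sin_pos_of_pos_of_lt_pi ha (by linarith)
  have sb : 0 < sin b := sin_pos_of_pos_of_lt_pi hb (by linarith)
  have h1 := mul_le_mul_of_nonneg_right (hsl a ⟨ha, by linarith⟩).2 sb.le
  have h2 := mul_le_mul_of_nonneg_right (hsr b ⟨hb, by linarith⟩).1 sa.le
  have h3 := mul_le_mul_of_nonneg_right hlr (mul_pos sa sb).le
  rw [← hn.eq] at h2
  rw [sin_add]
  linarith

/-- A nest lies in the convex body whose support function is the restriction to `[α - 2π, α]`. -/
theorem IsNest.proj_le {α t s : ℝ} {z : ℂ} (hn : IsNest ρ h α) (hg : IsTrigConvex (stretch ρ h))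
    (ht : t ∈ Ioo (α - 2 * π) α) (hz : z ∈ piece ρ h t) (hs : s ∈ Icc (α - 2 * π) α) :
    proj z s ≤ stretch ρ h s := by
  obtain ⟨y, hy, hproj⟩ := supports_of_mem_piece hg hz
  have hnear : ∀ x, |x - t| ≤ π → proj z x ≤ stretch ρ h x := fun x hx => by
    have := hy (x - t) hx
    rwa [← hproj, add_sub_cancel] at this
  rcases le_or_gt |s - t| π with hst | hst
  · exact hnear s hst
  have hp := periodic_proj z
  rcases lt_abs.1 hst with h1 | h1
  · -- here `s` is close to `α` and `t` is close to `α - 2π`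
    have hb := hnear (α - 2 * π) (abs_le.2 ⟨by linarith [hs.2], by linarith [ht.1, pi_pos]⟩)
    rcases hs.2.eq_or_lt with rfl | h2
    · rwa [← hn.eq, hp.sub_eq] at hb
    have hsa : 0 < sin (t - (α - 2 * π)) :=
      sin_pos_of_pos_of_lt_pi (by linarith [ht.1]) (by linarith)
    have hS : 0 < sin (α - s + (t - (α - 2 * π))) :=
      sin_pos_of_pos_of_lt_pi (by linarith [ht.1]) (by linarith)
    have k1 := hn.three_point hg (a := α - s) (b := t - (α - 2 * π)) (by linarith)
      (by linarith [ht.1]) (by linarith)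
    rw [sub_sub_cancel, add_sub_cancel] at k1
    rw [← hn.eq, hp.sub_eq] at hb
    have k2 := mul_le_mul_of_nonneg_right hb hS.le
    obtain ⟨A, B, c, hA⟩ : ∃ A B c, ∀ x, proj z x = sinusoid A B c x :=
      ⟨z.re, z.im, 0, fun x => by simp [proj, sinusoid]⟩
    have k3 := sinusoid_three_point A B c α (α - s) (t - (α - 2 * π))
    have e : α + (t - (α - 2 * π)) = t + 2 * π := by ring
    rw [sub_sub_cancel, e, ← hA, ← hA, ← hA, hp t] at k3
    have e0 : proj z t = stretch ρ h t := hz.1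
    rw [e0] at k3
    exact le_of_mul_le_mul_right (by linarith) hsa
  · -- here `s` is close to `α - 2π` and `t` is close to `α`
    have hb := hnear α (abs_le.2 ⟨by linarith [ht.2, pi_pos], by linarith [hs.1]⟩)
    rcases hs.1.eq_or_lt with rfl | h2
    · rwa [hp.sub_eq, ← hn.eq]
    have hsa : 0 < sin (α - t) :=
      sin_pos_of_pos_of_lt_pi (by linarith [ht.2]) (by linarith)
    have hS : 0 < sin (α - t + (s - (α - 2 * π))) :=
      sin_pos_of_pos_of_lt_pi (by linarith [ht.2]) (by linarith)
    have k1 := hn.three_point hg (a := α - t) (b := s - (α - 2 * π)) (by linarith [ht.2])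
      (by linarith) (by linarith)
    rw [sub_sub_cancel, add_sub_cancel] at k1
    have k2 := mul_le_mul_of_nonneg_right hb hS.le
    obtain ⟨A, B, c, hA⟩ : ∃ A B c, ∀ x, proj z x = sinusoid A B c x :=
      ⟨z.re, z.im, 0, fun x => by simp [proj, sinusoid]⟩
    have k3 := sinusoid_three_point A B c α (α - t) (s - (α - 2 * π))
    have e : α + (s - (α - 2 * π)) = s + 2 * π := by ring
    rw [sub_sub_cancel, e, ← hA, ← hA, ← hA, hp s] at k3
    have e0 : proj z t = stretch ρ h t := hz.1
    rw [e0] at k3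
    exact le_of_mul_le_mul_right (by linarith) hsa

/-- Every nest lies in a disk of radius `R`: the supporting sinusoid of the minorant at `α - π`,
valid on all of `[α - 2π, α]`, provides the center. -/
theorem IsNest.circumradius_le {P R α : ℝ} {τ : ℝ → ℝ} (hn : IsNest ρ h α)
    (hg : IsTrigConvex (stretch ρ h)) (hm : IsMinorant P R (stretch ρ h) τ) :
    circumradius (arc ρ h α) ≤ R := by
  have hpi := pi_pos
  obtain ⟨y, hy⟩ := hm.convex.exists_supports (α - π)
  obtain ⟨c, hc⟩ := exists_proj_eq_sinusoid (-τ (α - π)) (-y) (α - π)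
  have hR : 0 ≤ R := by
    have := hm.le 0; have := hm.le (0 + π)
    have := hg.antipodal 0; have := hm.convex.antipodal 0
    linarith
  refine csInf_le ⟨0, fun r hr => hr.1⟩ ⟨hR, c, fun z hz => ?_⟩
  simp only [arc, subarc, mem_iUnion] at hz
  obtain ⟨t, ht, hz⟩ := hz
  rw [mem_closedBall, dist_eq_norm]
  obtain ⟨s, hs, e⟩ := exists_proj_eq_norm (z - c) (α - 2 * π)
  have hs' : s ∈ Icc (α - 2 * π) α := ⟨hs.1, by linarith [hs.2]⟩
  have h1 := hn.proj_le hg ht hz hs'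
  have h2 := hy.sinusoid_le (x := s) (abs_le.2 ⟨by linarith [hs'.1], by linarith [hs'.2]⟩)
  have h3 := hm.le s
  have h4 := hc s
  rw [← e, proj_sub]
  simp only [sinusoid] at h2 h4
  linarith

/-- If contact points on a sinusoidal interval inside `[α - 2π, α]` meet every half-circle of
directions, then no disk of radius less than `R` contains the arc. -/
theorem le_circumradius {R α s e A B c : ℝ} {τ : ℝ → ℝ} (hρ : 0 < ρ) (hh : TC ρ h)
    (hse : s + π ≤ e) (hes : e < s + 2 * π) (hs : stretch ρ h s + τ s = R)
    (he : stretch ρ h e + τ e = R) (heq : ∀ x ∈ Icc s e, τ x = sinusoid A B c x)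
    (hcontact : ∀ x, ∃ t ∈ Icc x (x + π), stretch ρ h t + τ t = R)
    (hα : α ∈ Icc e (s + 2 * π)) : R ≤ circumradius (arc ρ h α) := by
  have hpi := pi_pos
  have hg := hh.isTrigConvex_stretch hρ
  have hcg := hg.continuous
  have hne : (arc ρ h α).Nonempty := by
    obtain ⟨z, hz, -⟩ := exists_mem_piece hg (α - π)
    exact ⟨z, mem_biUnion ⟨by linarith, by linarith⟩ hz⟩
  obtain ⟨⟨hr0, p, hp⟩, -⟩ := circumradius_isLeast hne (hh.isBounded_subarc hρ _)
  by_contra! hlt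
  have hle : ∀ t ∈ Icc (α - 2 * π) α, stretch ρ h t ≤ proj p t + circumradius (arc ρ h α) := by
    refine le_of_le_Ioo hcg ((continuous_proj p).add continuous_const) (by linarith) fun t ht => ?_
    simp only [Pi.add_apply]
    obtain ⟨z, hz, e⟩ := exists_mem_piece hg t
    have h1 := hp (mem_biUnion ht hz)
    rw [mem_closedBall, dist_eq_norm] at h1
    have h2 := (proj_le_norm (z - p) t).trans h1
    rw [proj_sub, e] at h2
    linarith
  obtain ⟨q, hq⟩ := exists_proj_eq_sinusoid A B c
  obtain ⟨w, hw⟩ : ∃ w : ℂ, ∀ t, proj w t = proj p t + proj q t :=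
    ⟨p + q, fun t => by simp only [proj, Complex.add_re, Complex.add_im]; ring⟩
  have hpos : ∀ t ∈ Icc s e, stretch ρ h t + τ t = R → 0 < proj w t := by
    intro t ht htR
    have := hle t ⟨by linarith [ht.1, hα.2], ht.2.trans hα.1⟩
    rw [heq t ht, ← hq] at htR
    rw [hw]
    linarith
  have hperw := periodic_proj w
  obtain ⟨x, hx, hxneg⟩ : ∃ x ∈ Ico s (s + 2 * π), ∀ t ∈ Icc x (x + π), proj w t ≤ 0 := by
    obtain ⟨x, hx, k, hk⟩ : ∃ x ∈ Ico s (s + 2 * π), ∃ k : ℤ, w.arg + π / 2 - k * (2 * π) = x :=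
      ⟨_, by simpa only [zsmul_eq_mul] using
        sub_toIcoDiv_zsmul_mem_Ico two_pi_pos s (w.arg + π / 2), _, rfl⟩
    refine ⟨x, hx, fun t ht => ?_⟩
    rw [proj_eq_norm_mul_cos]
    refine mul_nonpos_of_nonneg_of_nonpos (norm_nonneg _) ?_
    rw [← cos_add_int_mul_two_pi _ k]
    exact cos_nonpos_of_pi_div_two_le_of_le (by linarith [ht.1]) (by linarith [ht.2])
  -- The closed half-circle on which `proj w ≤ 0` must avoid all contact points.
  rcases le_or_gt x (e - π) with h1 | h1
  · obtain ⟨t, ht, htR⟩ := hcontact x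
    exact (hpos t ⟨hx.1.trans ht.1, by linarith [ht.2]⟩ htR).not_ge (hxneg t ht)
  rcases le_or_gt x e with h2 | h2
  · exact (hpos e ⟨by linarith, le_rfl⟩ he).not_ge (hxneg e ⟨h2, by linarith⟩)
  · have := hxneg (s + 2 * π) ⟨hx.2.le, by linarith⟩
    rw [hperw s] at this
    exact (hpos s ⟨le_rfl, by linarith⟩ hs).not_ge this

/-- Where `g - g(· - 2π)` changes sign from nonnegative to nonpositive, the nest condition holds. -/
theorem IsTrigConvex.exists_crossing {g : ℝ → ℝ} (hg : IsTrigConvex g) {a b : ℝ} (hab : a < b)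
    (ha : g (a - 2 * π) ≤ g a) (hb : g b ≤ g (b - 2 * π)) :
    ∃ α ∈ Icc a b, g α = g (α - 2 * π) ∧ ∃ l r, HasDerivWithinAt g l (Iic α) α ∧
      HasDerivWithinAt g r (Ici (α - 2 * π)) (α - 2 * π) ∧ l ≤ r := by
  have hcg := hg.continuous
  obtain ⟨F, hF⟩ : ∃ F : ℝ → ℝ, F = fun x => g x - g (x - 2 * π) := ⟨_, rfl⟩
  have hcF : Continuous F := by rw [hF]; fun_prop
  have hFa : 0 ≤ F a := by rw [hF]; exact sub_nonneg.2 ha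
  have hFb : F b ≤ 0 := by rw [hF]; exact sub_nonpos.2 hb
  -- One-sided derivatives of `F` are differences of those of `g`.
  have hshift : ∀ {α d : ℝ} {S T : Set ℝ}, HasDerivWithinAt g d T (α - 2 * π) →
      MapsTo (fun x => x - 2 * π) S T → HasDerivWithinAt (fun x => g (x - 2 * π)) d S α := by
    intro α d S T hd hm
    have := HasDerivWithinAt.scomp α hd ((hasDerivAt_id α).sub_const (2 * π)).hasDerivWithinAt hm
    simpa [Function.comp_def] using this
  -- If `F` is positive somewhere, take the last point `α` of the closure of `{F > 0}`: there
  -- `F α = 0` and the left derivative of `F` is at most `0`. Otherwise `F ≤ 0` and `α = a`.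
  by_cases hS : ∃ x ∈ Icc a b, 0 < F x
  · obtain ⟨D, hD⟩ : ∃ D : Set ℝ, D = {x | x ∈ Icc a b ∧ 0 < F x} := ⟨_, rfl⟩
    have hDne : D.Nonempty := by rw [hD]; obtain ⟨x, hx, hx'⟩ := hS; exact ⟨x, hx, hx'⟩
    have hDb : BddAbove D := ⟨b, fun x hx => by rw [hD] at hx; exact hx.1.2⟩
    have hcl := csSup_mem_closure hDne hDb
    obtain ⟨α, hα⟩ : ∃ α, α = sSup D := ⟨_, rfl⟩
    rw [← hα] at hcl
    have hmem : α ∈ Icc a b := by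
      refine closure_minimal (fun x hx => ?_) isClosed_Icc hcl
      rw [hD] at hx; exact hx.1
    have hF0 : 0 ≤ F α := by
      refine closure_minimal (t := {x | 0 ≤ F x}) (fun x hx => ?_)
        (isClosed_le continuous_const hcF) hcl
      rw [hD] at hx; exact hx.2.le
    have hF0' : F α ≤ 0 := by
      rcases hmem.2.eq_or_lt with e | hlt
      · rw [e]; exact hFb
      · refine le_of_le_Ioo hcF continuous_const hlt (fun x hx => ?_) α ⟨le_rfl, hlt.le⟩
        by_contra! hpos
        have : x ∈ D := by rw [hD]; exact ⟨⟨hmem.1.trans hx.1.le, hx.2.le⟩, hpos⟩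
        exact (le_csSup hDb this).not_gt (hα ▸ hx.1)
    have hFα := hF0'.antisymm hF0
    obtain ⟨l, -, hl, -, -, -⟩ := hg.exists_derivs α
    obtain ⟨l', r', hl', hr', hlr', -⟩ := hg.exists_derivs (α - 2 * π)
    refine ⟨α, hmem, by rw [hF] at hFα; exact sub_eq_zero.1 hFα, l, r', hl, hr', ?_⟩
    have hd : HasDerivWithinAt F (l - l') (Iic α) α := by
      rw [hF]
      exact hl.sub (hshift hl' fun x hx => sub_le_sub_right (mem_Iic.1 hx) _)
    have hd := (hasDerivWithinAt_iff_tendsto_slope.1 hd)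
    suffices l - l' ≤ 0 by linarith
    by_contra! hpos
    have hev := hd.eventually (lt_mem_nhds hpos)
    rw [eventually_nhdsWithin_iff] at hev
    obtain ⟨x, hx, hxD⟩ := mem_closure_iff_frequently.1 hcl |>.and_eventually hev |>.exists
    have hxα : x ≠ α := by
      rintro rfl
      rw [hD] at hx
      exact hx.2.ne' hFα
    have hle : x ≤ α := by rw [hα]; exact le_csSup hDb hx
    have h1 := hxD ⟨hle, hxα⟩
    rw [slope_def_field, hFα, sub_zero] at h1
    rw [hD] at hx
    exact h1.not_ge (div_nonpos_of_nonneg_of_nonpos hx.2.le (by linarith))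
  · push Not at hS
    have hFα : F a = 0 := (hS a ⟨le_rfl, hab.le⟩).antisymm hFa
    obtain ⟨l, r, hl, hr, hlr, -⟩ := hg.exists_derivs a
    obtain ⟨-, r', -, hr', -, -⟩ := hg.exists_derivs (a - 2 * π)
    refine ⟨a, ⟨le_rfl, hab.le⟩, by rw [hF] at hFα; exact sub_eq_zero.1 hFα, l, r', hl, hr',
      hlr.trans ?_⟩
    have hd : HasDerivWithinAt F (r - r') (Ici a) a := by
      rw [hF]
      exact hr.sub (hshift hr' fun x hx => sub_le_sub_right (mem_Ici.1 hx) _)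
    rw [← hasDerivWithinAt_Ioi_iff_Ici, hasDerivWithinAt_iff_tendsto_slope' (by simp)] at hd
    suffices r - r' ≤ 0 by linarith
    refine le_of_tendsto hd ?_
    filter_upwards [Ioo_mem_nhdsGT hab] with x hx
    rw [slope_def_field, hFα, sub_zero]
    exact div_nonpos_of_nonpos_of_nonneg (hS x ⟨hx.1.le, hx.2.le⟩) (by linarith [hx.1])

/-! ### The extremal nest -/

/-- A minorant at level `R` that is a sinusoid on an interval of length between `π` and `2π` with
contact at both ends yields a sign change of `g - g(· - 2π)`, hence a point with the nest
condition. -/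
theorem IsMinorant.exists_nest_condition {P R s e A B c : ℝ} {g τ : ℝ → ℝ}
    (hm : IsMinorant P R g τ) (hg : IsTrigConvex g) (hse : s + π ≤ e) (hes : e < s + 2 * π)
    (hs : g s + τ s = R) (he : g e + τ e = R) (heq : ∀ x ∈ Icc s e, τ x = sinusoid A B c x) :
    ∃ α ∈ Icc e (s + 2 * π), g α = g (α - 2 * π) ∧ ∃ l r, HasDerivWithinAt g l (Iic α) α ∧
      HasDerivWithinAt g r (Ici (α - 2 * π)) (α - 2 * π) ∧ l ≤ r := by
  have hpi := pi_pos
  obtain ⟨z, hz⟩ := exists_proj_eq_sinusoid A B c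
  have hper : Function.Periodic (sinusoid A B c) (2 * π) := fun t => by
    rw [← hz, ← hz, periodic_proj z t]
  have hσ : ∀ x ∈ Icc s e, sinusoid A B c x = τ x := fun x hx => (heq x hx).symm
  have hσs := hσ s ⟨le_rfl, by linarith⟩
  have hσe := hσ e ⟨by linarith, le_rfl⟩
  refine hg.exists_crossing hes ?_ ?_
  · have h1 := hm.convex.sinusoid_le_left (show s < s + π / 2 by linarith) (by linarith) hσs
      (hσ (s + π / 2) ⟨by linarith, by linarith⟩) (e - 2 * π - s)
      (abs_le.2 ⟨by linarith, by linarith⟩) (by linarith)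
    rw [add_sub_cancel, hper.sub_eq, hσe] at h1
    linarith [hm.le (e - 2 * π)]
  · have h1 := hm.convex.sinusoid_le_right (show e - π / 2 < e by linarith) (by linarith)
      (hσ (e - π / 2) ⟨by linarith, by linarith⟩) hσe (s + 2 * π - e)
      (abs_le.2 ⟨by linarith, by linarith⟩) (by linarith)
    rw [add_sub_cancel, hper s, hσs] at h1
    rw [add_sub_cancel_right]
    linarith [hm.le (s + 2 * π)]

/-- The lowest level at which the obstacle `R - g` has a trigonometrically convex minorant is the
circumradius of a nest. -/
theorem TC.exists_extremal_nest {ρ : ℝ} {h : ℝ → ℝ} (hρ : 0 < ρ) (hh : TC ρ h) :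
    ∃ R τ, IsMinorant (2 * π * ρ) R (stretch ρ h) τ ∧
      ∃ α, IsNest ρ h α ∧ R ≤ circumradius (arc ρ h α) := by
  have hg := hh.isTrigConvex_stretch hρ
  have hcg := hg.continuous
  have hQ := hh.periodic_stretch hρ
  have hQ0 : 0 < 2 * π * ρ := by positivity
  -- The modifications of a minorant need room, so a period longer than `π` is used.
  obtain ⟨m, hm⟩ := exists_nat_gt (π / (2 * π * ρ))
  rw [div_lt_iff₀ hQ0] at hm
  have hP : Function.Periodic (stretch ρ h) (m * (2 * π * ρ)) := hQ.nat_mul m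
  obtain ⟨M, hM⟩ := hh.bounded hρ
  obtain ⟨R, hex, hmin⟩ := exists_least_level (P := m * (2 * π * ρ)) hg fun t => hM (t / ρ)
  obtain ⟨t₀, hforced⟩ := exists_forced_contact (pi_pos.trans hm) hcg hP hex hmin
  obtain ⟨τ, hτ⟩ := exists_isGreatestMinorant hex
  have hτQ := hτ.periodic_of hQ
  obtain ⟨s, e, A, B, c, hse, hes, hs, he, heq⟩ :=
    hτ.exists_sinusoidal_interval hg hP hm hforced
  obtain ⟨α, hα, hαeq, l, r, hl, hr, hlr⟩ :=
    hτ.toIsMinorant.exists_nest_condition hg hse hes hs he heq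
  -- Translate everything by a multiple of the period so that `α` lands in `[0, 2πρ)`.
  obtain ⟨k, hk⟩ : ∃ k : ℤ, α - k * (2 * π * ρ) ∈ Ico 0 (2 * π * ρ) :=
    ⟨_, by simpa only [zsmul_eq_mul, zero_add] using sub_toIcoDiv_zsmul_mem_Ico hQ0 0 α⟩
  obtain ⟨v, hv⟩ : ∃ v, v = (k : ℝ) * (2 * π * ρ) := ⟨_, rfl⟩
  rw [← hv] at hk
  have hgv : ∀ x, stretch ρ h (x - v) = stretch ρ h x := fun x => by
    rw [hv]; exact hQ.sub_int_mul_eq k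
  have hτv : ∀ x, τ (x - v) = τ x := fun x => by rw [hv]; exact hτQ.sub_int_mul_eq k
  have hgv' : ∀ x, stretch ρ h (x + v) = stretch ρ h x := fun x => by
    rw [← hgv, add_sub_cancel_right]
  have hτv' : ∀ x, τ (x + v) = τ x := fun x => by rw [← hτv, add_sub_cancel_right]
  have hshift : ∀ {d x : ℝ} {S T : Set ℝ}, HasDerivWithinAt (stretch ρ h) d S x →
      MapsTo (fun u => u + v) T S → HasDerivWithinAt (stretch ρ h) d T (x - v) := by
    intro d x S T hd hm
    have := HasDerivWithinAt.scomp_of_eq (x - v) hd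
      ((hasDerivAt_id (x - v)).add_const v).hasDerivWithinAt hm (by simp)
    simpa [Function.comp_def, hgv'] using this
  have e2 : α - v - 2 * π = α - 2 * π - v := by ring
  refine ⟨R, τ, ⟨hτQ, hτ.convex, hτ.le⟩, α - v, ⟨hk, by rw [e2, hgv, hgv, hαeq], l, r,
    hshift hl fun x hx => ?_, ?_, hlr⟩, ?_⟩
  · simp only [mem_Iic] at hx ⊢; linarith
  · rw [e2]
    exact hshift hr fun x hx => by simp only [mem_Ici] at hx ⊢; linarith
  · refine le_circumradius (s := s - v) (e := e - v) (A := A) (B := B) (c := c - v) (τ := τ) hρ hh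
      (by linarith) (by linarith) (by rw [hgv, hτv, hs]) (by rw [hgv, hτv, he]) (fun x hx => ?_)
      (hτ.exists_contact hcg hP hm) ⟨by linarith [hα.1], by linarith [hα.2]⟩
    rw [← hτv', heq (x + v) ⟨by linarith [hx.1], by linarith [hx.2]⟩]
    have : x + v - c = x - (c - v) := by ring
    simp only [sinusoid, this]

end TrigConvex

end

theorem propositionP4 (ρ : ℝ) (hρ : 0 < ρ) (h : ℝ → ℝ) (hh : TrigConvex.TC ρ h) :
    IsGreatest (TrigConvex.localCircumradii ρ h) (TrigConvex.maxLocalCircumradius ρ h) ∧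
      ∃ τ : ℝ → ℝ, TrigConvex.TC ρ τ ∧
        ∀ t : ℝ, h t + τ t ≤ TrigConvex.maxLocalCircumradius ρ h := by
  obtain ⟨R, τ, hτ, α, hα, hRα⟩ := hh.exists_extremal_nest hρ
  have hg := hh.isTrigConvex_stretch hρ
  have hgr : IsGreatest (TrigConvex.localCircumradii ρ h) R := by
    refine ⟨⟨α, hα, hRα.antisymm (hα.circumradius_le hg hτ)⟩, ?_⟩
    rintro _ ⟨β, hβ, rfl⟩
    exact hβ.circumradius_le hg hτ
  have hR : TrigConvex.maxLocalCircumradius ρ h = R := hgr.csSup_eq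
  rw [hR]
  refine ⟨hgr, fun t => τ (ρ * t), ⟨fun t => ?_, fun t₁ t₂ t₃ h12 h23 h13 => ?_⟩, fun t => ?_⟩
  · have e : ρ * (t + 2 * Real.pi) = ρ * t + 2 * Real.pi * ρ := by ring
    simp only [e, hτ.periodic (ρ * t)]
  · rw [lt_div_iff₀ hρ] at h13
    have := hτ.convex (ρ * t₂) (ρ * (t₂ - t₁)) (ρ * (t₃ - t₂)) (mul_pos hρ (sub_pos.2 h12))
      (mul_pos hρ (sub_pos.2 h23)) (by linarith)
    have e1 : ρ * (t₂ - t₁) + ρ * (t₃ - t₂) = ρ * (t₃ - t₁) := by ring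
    have e2 : ρ * t₂ - ρ * (t₂ - t₁) = ρ * t₁ := by ring
    have e3 : ρ * t₂ + ρ * (t₃ - t₂) = ρ * t₃ := by ring
    have e4 : ρ * (t₂ - t₃) = -(ρ * (t₃ - t₂)) := by ring
    have e5 : ρ * (t₁ - t₂) = -(ρ * (t₂ - t₁)) := by ring
    rw [e1, e2, e3] at this
    rw [e4, e5, Real.sin_neg, Real.sin_neg]
    linarith
  · have := hτ.le (ρ * t)
    rwa [TrigConvex.stretch, mul_div_cancel_left₀ _ hρ.ne'] at this
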